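/- Let $\mathcal G$ be a connected metric graph with finitely many vertices and edges; loops and multiple edges are allowed. Each edge is a closed interval $I_e\subset\mathbb R$ with end points $-\infty\le a_e<b_e\le+\infty$, $I_e\neq\mathbb R$, and vertices at infinity have degree one. Let $$\ell=-\frac{d}{dt}\Big(P\frac{d}{dt}+Q\Big)+Q^{T}\frac{d}{dt}+R$$ where on every closed edge $P$ is a $C^1$ function with values in the symmetric positive definite $d\times d$ matrices, $Q$ is a $C^1$ matrix function and $R$ is a continuous symmetric matrix function. Let $L$ be the minimal operator of $\ell$ in $H=L^2(\mathcal G;\mathbb R^d)=\bigoplus_e L^2(I_e;\mathbb R^d)$, i.e. the closure of $\ell$ on smooth functions compactly supported in the interiors of the edges, and let $L^*$ be its adjoint (the maximal operator). Assume that $L^*$ is Fredholm and that the quadratic form $x\mapsto\langle Lx,x\rangle$ of $L$ is bounded from below. Let $\operatorname{dom}(L^*)=\operatorname{dom}(L)\oplus U$ be a decomposition with $\ker L^*\subset U$, let $p:\operatorname{dom}(L^*)\to U$ be the projection onto the second summand, and let $\rho$ be the restriction to $U$ of $\omega(f,g)=\langle f,L^*g\rangle-\langle L^*f,g\rangle$.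 A subspace $\Lambda\subset U$ is Lagrangian if it equals its $\rho$-annihilator; put $L_\Lambda=L^*|_{\operatorname{dom}(L)\oplus\Lambda}$. Let $\Lambda_D=U\cap\operatorname{dom}(L_F)$, where $L_F$ is the Friedrichs extension of $L$. The Morse index $\mathrm{iMor}(A)\in\{0,1,\dots,\infty\}$ of an operator $A$ is the supremum of the dimensions of the finite-dimensional subspaces of $\operatorname{dom}(A)$ on which $\langle Ax,x\rangle$ is negative definite. The triple index of Lagrangian subspaces $\alpha,\beta,\gamma$ of $(U,\rho)$ is $$\iota(\alpha,\beta,\gamma)=n_+Q(\alpha,\beta;\gamma)+\dim(\alpha\cap\gamma)-\dim(\alpha\cap\beta\cap\gamma),$$ where $n_+$ denotes the maximal dimension of a positive definite subspace and $Q(\alpha,\beta;\gamma)$ is the quadratic form on $\alpha\cap(\beta+\gamma)$ given by $Q[u]=\rho(u,b)$ for any $b\in\beta$ with $u+b\in\gamma$. Then $U$ is finite-dimensional, and $p(\ker L^*)$ and $\Lambda_D$ are Lagrangian in $(U,\rho)$. Let $\Lambda_0,\Lambda_1$ be Lagrangian subspaces of $(U,\rho)$. Then $\mathrm{iMor}(L_{\Lambda_0})$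 and $\mathrm{iMor}(L_{\Lambda_1})$ are either both finite or both infinite, and if they are finite, $$\mathrm{iMor}(L_{\Lambda_1})-\mathrm{iMor}(L_{\Lambda_0})=\iota\big(p(\ker L^*),\Lambda_1,\Lambda_0\big)-\iota(\Lambda_1,\Lambda_0,\Lambda_D).$$ -/

import Mathlib

namespace QuantumGraph

noncomputable section

open MeasureTheory Filter Topology
open scoped ContDiff

/-! ### Indices of inertia, Lagrangian subspaces, the triple index -/

section Index

variable {X : Type*} [AddCommGroup X] [Module ℝ X]

/-- The positive index `n₊` (coindex): the supremum of the dimensions of the finite-dimensional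
subspaces on which `q` is positive definite. -/
def posIndex (q : X → ℝ) : ℕ∞ :=
  ⨆ (W : Submodule ℝ X) (_ : FiniteDimensional ℝ W) (_ : ∀ x ∈ W, x ≠ 0 → 0 < q x),
    (Module.finrank ℝ W : ℕ∞)

/-- The Morse index: the supremum of the dimensions of the finite-dimensional subspaces on which
`q` is negative definite. -/
def negIndex (q : X → ℝ) : ℕ∞ := posIndex fun x => -q x

/-- `μ` is Lagrangian for the skew form `σ`: it equals its own `σ`-annihilator. -/
def IsLagrangian (σ : LinearMap.BilinForm ℝ X) (μ : Submodule ℝ X) : Prop :=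
  σ.orthogonal μ = μ

theorem exists_decomp {α β γ : Submodule ℝ X} (u : ↥(α ⊓ (β ⊔ γ))) :
    ∃ b ∈ β, (u : X) + b ∈ γ := by
  obtain ⟨y, hy, z, hz, h⟩ := Submodule.mem_sup.1 u.2.2
  refine ⟨-y, β.neg_mem hy, ?_⟩
  rw [← h]
  simpa using hz

/-- The quadratic form `Q(α, β; γ)` on `α ∩ (β + γ)`: `Q[u] = σ(u, b)` where `b ∈ β` is such that
`u + b ∈ γ`.  See `tripleForm_eq` for the independence of the choice of `b`. -/
def tripleForm (σ : LinearMap.BilinForm ℝ X) (α β γ : Submodule ℝ X) (u : ↥(α ⊓ (β ⊔ γ))) : ℝ :=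
  σ u (exists_decomp u).choose

theorem tripleForm_eq {σ : LinearMap.BilinForm ℝ X} {α β γ : Submodule ℝ X}
    (hβ : IsLagrangian σ β) (hγ : IsLagrangian σ γ) (u : ↥(α ⊓ (β ⊔ γ))) {b : X} (hb : b ∈ β)
    (hub : (u : X) + b ∈ γ) : tripleForm σ α β γ u = σ u b := by
  obtain ⟨h1, h2⟩ := (exists_decomp u).choose_spec
  set b' := (exists_decomp u).choose with hb'
  have isoβ : ∀ x ∈ β, ∀ y ∈ β, σ x y = 0 := fun x hx y hy => by
    rw [← hβ] at hy
    exact hy x hx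
  have isoγ : ∀ x ∈ γ, ∀ y ∈ γ, σ x y = 0 := fun x hx y hy => by
    rw [← hγ] at hy
    exact hy x hx
  have hd : b' - b ∈ γ := by
    have := γ.sub_mem h2 hub
    simpa using this
  have e1 := isoγ _ hub _ hd
  have e2 := isoβ _ hb _ (β.sub_mem h1 hb)
  simp only [map_add, LinearMap.add_apply, map_sub] at e1 e2
  change σ u b' = σ u b
  linarith

/-- The triple index
`ι(α, β, γ) = n₊ Q(α, β; γ) + dim (α ∩ γ) - dim (α ∩ β ∩ γ)`
of Lagrangian subspaces of a finite-dimensional symplectic space. -/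
def tripleIndex (σ : LinearMap.BilinForm ℝ X) (α β γ : Submodule ℝ X) : ℤ :=
  ((posIndex (tripleForm σ α β γ)).toNat : ℤ)
    + (Module.finrank ℝ ↥(α ⊓ γ) : ℤ) - (Module.finrank ℝ ↥(α ⊓ β ⊓ γ) : ℤ)

end Index

/-! ### Unbounded operators -/

section Operator

variable {H : Type*} [NormedAddCommGroup H] [InnerProductSpace ℝ H]

/-- The Fredholm property of a (closed) unbounded operator: finite-dimensional kernel, closed
range, finite-dimensional cokernel. -/
def IsFredholm (A : H →ₗ.[ℝ] H) : Prop :=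
  FiniteDimensional ℝ ↥(LinearMap.ker A.toFun) ∧
    IsClosed (LinearMap.range A.toFun : Set H) ∧
    FiniteDimensional ℝ (H ⧸ LinearMap.range A.toFun)

/-- The quadratic form `q_A[x] = ⟨A x, x⟩` on the domain of `A`. -/
def opForm (A : H →ₗ.[ℝ] H) (x : A.domain) : ℝ := inner ℝ (A x) (x : H)

/-- The Morse index of `A`, the negative index of `⟨A x, x⟩` on `dom A`. -/
def morseIndex (A : H →ₗ.[ℝ] H) : ℕ∞ := negIndex (opForm A)

/-- The quadratic form of `A` is bounded from below. -/
def IsLowerBounded (A : H →ₗ.[ℝ] H) : Prop :=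
  ∃ c : ℝ, ∀ x : A.domain, c * ‖(x : H)‖ ^ 2 ≤ opForm A x

theorem opForm_parallelogram (A : H →ₗ.[ℝ] H) (x y : A.domain) :
    opForm A (x + y) + opForm A (x - y) = 2 * opForm A x + 2 * opForm A y := by
  simp only [opForm, LinearPMap.map_add, LinearPMap.map_sub, Submodule.coe_add, Submodule.coe_sub,
    inner_add_left, inner_add_right, inner_sub_left, inner_sub_right]
  ring

theorem opForm_smul (A : H →ₗ.[ℝ] H) (r : ℝ) (x : A.domain) :
    opForm A (r • x) = r ^ 2 * opForm A x := by
  simp only [opForm, LinearPMap.map_smul, Submodule.coe_smul, real_inner_smul_left,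
    real_inner_smul_right]
  ring

theorem tendsto_sub_atTop {H : Type*} [NormedAddCommGroup H] {u : ℕ → H} {x : H} (hu : Tendsto u atTop (𝓝 x)) :
    Tendsto (fun p : ℕ × ℕ => u p.1 - u p.2) atTop (𝓝 0) := by
  rw [← prod_atTop_atTop_eq]
  simpa using (hu.comp tendsto_fst).sub (hu.comp tendsto_snd)

variable [CompleteSpace H]

/-- The domain of the Friedrichs extension of `A`, as a subspace of `dom A*`: the elements of
`dom A*` lying in the form domain of `A`, i.e. the limits in `H` of sequences in `dom A` which
are Cauchy for the quadratic form of `A`. -/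
def friedrichsDomain (A : H →ₗ.[ℝ] H) (hA : IsLowerBounded A) : Submodule ℝ A.adjoint.domain where
  carrier := {x | ∃ u : ℕ → A.domain, Tendsto (fun n => (u n : H)) atTop (𝓝 (x : H)) ∧
    Tendsto (fun p : ℕ × ℕ => opForm A (u p.1 - u p.2)) atTop (𝓝 0)}
  zero_mem' := ⟨fun _ => 0, by simp, by simp [opForm]⟩
  smul_mem' := by
    rintro r x ⟨u, hu, hq⟩
    refine ⟨fun n => r • u n, by simpa using hu.const_smul r, ?_⟩
    have := hq.const_mul (r ^ 2)
    simpa only [← smul_sub, opForm_smul, mul_zero] using this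
  add_mem' := by
    rintro x y ⟨u, hu, hq⟩ ⟨v, hv, hr⟩
    obtain ⟨c, hc⟩ := hA
    refine ⟨fun n => u n + v n, by simpa using hu.add hv, ?_⟩
    have hU := tendsto_sub_atTop hu
    have hV := tendsto_sub_atTop hv
    have key : ∀ p : ℕ × ℕ, (u p.1 + v p.1) - (u p.2 + v p.2)
        = (u p.1 - u p.2) + (v p.1 - v p.2) := fun p => by abel
    have hlo : Tendsto (fun p : ℕ × ℕ =>
        c * ‖((u p.1 : H) - u p.2) + ((v p.1 : H) - v p.2)‖ ^ 2) atTop (𝓝 0) := by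
      simpa using ((hU.add hV).norm.pow 2).const_mul c
    have hhi : Tendsto (fun p : ℕ × ℕ =>
        2 * opForm A (u p.1 - u p.2) + 2 * opForm A (v p.1 - v p.2)
          - c * ‖((u p.1 : H) - u p.2) - ((v p.1 : H) - v p.2)‖ ^ 2) atTop (𝓝 0) := by
      simpa using ((hq.const_mul 2).add (hr.const_mul 2)).sub
        (((hU.sub hV).norm.pow 2).const_mul c)
    refine tendsto_of_tendsto_of_tendsto_of_le_of_le hlo hhi (fun p => ?_) (fun p => ?_)
    · have := hc ((u p.1 - u p.2) + (v p.1 - v p.2))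
      simpa only [key, Submodule.coe_add, Submodule.coe_sub] using this
    · have h1 := hc ((u p.1 - u p.2) - (v p.1 - v p.2))
      have h2 := opForm_parallelogram A (u p.1 - u p.2) (v p.1 - v p.2)
      simp only [Submodule.coe_sub] at h1
      simp only [key]
      linarith

/-- `dom A`, as a subspace of `dom A*`. -/
def minDomain (A : H →ₗ.[ℝ] H) : Submodule ℝ A.adjoint.domain :=
  A.domain.comap A.adjoint.domain.subtype

/-- `ker A*`, as a subspace of `dom A*`. -/
def kerAdjoint (A : H →ₗ.[ℝ] H) : Submodule ℝ A.adjoint.domain :=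
  LinearMap.ker A.adjoint.toFun

/-- The skew form `σ(f, g) = ⟨f, A* g⟩ - ⟨A* f, g⟩` on `dom A*`. -/
def boundaryForm (A : H →ₗ.[ℝ] H) : LinearMap.BilinForm ℝ A.adjoint.domain :=
  (innerₗ H).compl₁₂ A.adjoint.domain.subtype A.adjoint.toFun -
    (innerₗ H).compl₁₂ A.adjoint.toFun A.adjoint.domain.subtype

theorem boundaryForm_apply (A : H →ₗ.[ℝ] H) (f g : A.adjoint.domain) :
    boundaryForm A f g = inner ℝ (f : H) (A.adjoint g) - inner ℝ (A.adjoint f) (g : H) := rfl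

/-- The form `ρ = σ|_U` on a subspace `U` of `dom A*`. -/
def rho (A : H →ₗ.[ℝ] H) (U : Submodule ℝ A.adjoint.domain) : LinearMap.BilinForm ℝ U :=
  (boundaryForm A).restrict U

/-- The extension `A_Λ = A*|_{dom A ⊕ Λ}` attached to a subspace `Λ` of `U`. -/
def extension (A : H →ₗ.[ℝ] H) {U : Submodule ℝ A.adjoint.domain} (Λ : Submodule ℝ U) :
    H →ₗ.[ℝ] H :=
  A.adjoint.domRestrict ((minDomain A ⊔ Λ.map U.subtype).map A.adjoint.domain.subtype)

/-- `Λ_D = U ∩ dom (A_F)`, where `A_F` is the Friedrichs extension of `A`. -/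
def friedrichsSubspace (A : H →ₗ.[ℝ] H) (hA : IsLowerBounded A)
    (U : Submodule ℝ A.adjoint.domain) : Submodule ℝ U :=
  (friedrichsDomain A hA).comap U.subtype

/-- `p (ker A*)`, where `p : dom A* → U` is the projection onto the second summand of
`dom A* = dom A ⊕ U`. -/
def cauchySubspace (A : H →ₗ.[ℝ] H) (U : Submodule ℝ A.adjoint.domain)
    (hU : IsCompl (minDomain A) U) : Submodule ℝ U :=
  (kerAdjoint A).map (U.projectionOnto (minDomain A) hU.symm)

end Operator

/-! ### Metric graphs and Sturm-Liouville operators on them -/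

/-- A connected, oriented metric graph with vertex set `V` and edge set `E`; loops and multiple
edges are allowed.  The edge `e` is the closed interval of `ℝ` with endpoints `lo e < hi e` in
`[-∞, ∞]`, not both infinite; `left e`, `right e` are the vertices at these endpoints.  A vertex
at an infinite endpoint has degree one. -/
structure MetricGraph (V E : Type*) where
  left : E → V
  right : E → V
  lo : E → EReal
  hi : E → EReal
  lo_lt_hi : ∀ e, lo e < hi e
  not_line : ∀ e, lo e ≠ ⊥ ∨ hi e ≠ ⊤
  connected : ∀ v w : V, Relation.ReflTransGen
    (fun x y => ∃ e, (left e = x ∧ right e = y) ∨ (left e = y ∧ right e = x)) v w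
  deg_one_left : ∀ e, lo e = ⊥ → ∀ e', (left e' = left e → e' = e) ∧ right e' ≠ left e
  deg_one_right : ∀ e, hi e = ⊤ → ∀ e', (right e' = right e → e' = e) ∧ left e' ≠ right e

variable {V E : Type*}

/-- The closed interval `I_e`. -/
def MetricGraph.edge (G : MetricGraph V E) (e : E) : Set ℝ :=
  {t : ℝ | G.lo e ≤ (t : EReal) ∧ (t : EReal) ≤ G.hi e}

/-- The interior of `I_e`. -/
def MetricGraph.inner (G : MetricGraph V E) (e : E) : Set ℝ :=
  {t : ℝ | G.lo e < (t : EReal) ∧ (t : EReal) < G.hi e}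

theorem MetricGraph.isOpen_inner (G : MetricGraph V E) (e : E) : IsOpen (G.inner e) :=
  (isOpen_lt continuous_const continuous_coe_real_ereal).inter
    (isOpen_lt continuous_coe_real_ereal continuous_const)

theorem MetricGraph.inner_subset_edge (G : MetricGraph V E) (e : E) : G.inner e ⊆ G.edge e :=
  fun _ h => ⟨h.1.le, h.2.le⟩

/-- `ℝ^d` with its Euclidean structure. -/
abbrev Vec (d : ℕ) : Type := EuclideanSpace ℝ (Fin d)

/-- `L²(G; ℝ^d)`, the Hilbert direct sum of the spaces `L²(I_e; ℝ^d)`. -/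
abbrev MetricGraph.L2 [Fintype E] (G : MetricGraph V E) (d : ℕ) : Type _ :=
  PiLp 2 fun e : E => Lp (Vec d) 2 (volume.restrict (G.inner e))

/-- Coefficients of a Sturm-Liouville expression
`ℓ = -d/dt (P d/dt + Q) + Qᵀ d/dt + R` on `G`:
on each closed edge, `P` is `C¹`, symmetric and positive definite (equivalently `P⁻¹` is), `Q` is
`C¹`, and `R` is continuous and symmetric.  Matrices are regarded as endomorphisms of `ℝ^d`. -/
structure SturmLiouville (G : MetricGraph V E) (d : ℕ) where
  P : E → ℝ → (Vec d →L[ℝ] Vec d)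
  Q : E → ℝ → (Vec d →L[ℝ] Vec d)
  R : E → ℝ → (Vec d →L[ℝ] Vec d)
  contDiffOn_P : ∀ e, ContDiffOn ℝ 1 (P e) (G.edge e)
  contDiffOn_Q : ∀ e, ContDiffOn ℝ 1 (Q e) (G.edge e)
  continuousOn_R : ∀ e, ContinuousOn (R e) (G.edge e)
  symm_P : ∀ e, ∀ t ∈ G.edge e, IsSelfAdjoint (P e t)
  symm_R : ∀ e, ∀ t ∈ G.edge e, IsSelfAdjoint (R e t)
  pos_P : ∀ e, ∀ t ∈ G.edge e, ∀ v : Vec d, v ≠ 0 → 0 < inner ℝ (P e t v) v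

/-- Test functions: families of smooth functions with compact support in the interiors of the
edges. -/
def testFunctions (G : MetricGraph V E) (d : ℕ) : Submodule ℝ (E → ℝ → Vec d) where
  carrier := {f | ∀ e, ContDiff ℝ ∞ (f e) ∧ HasCompactSupport (f e) ∧ tsupport (f e) ⊆ G.inner e}
  zero_mem' := fun e => ⟨contDiff_const, HasCompactSupport.zero, by
    simp [tsupport]⟩
  add_mem' := fun {f g} hf hg e => ⟨(hf e).1.add (hg e).1, (hf e).2.1.add (hg e).2.1,
    (tsupport_add (f e) (g e)).trans (Set.union_subset (hf e).2.2 (hg e).2.2)⟩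
  smul_mem' := fun r f hf e => ⟨(hf e).1.const_smul r,
    (hf e).2.1.smul_left (f := fun _ => r),
    (closure_mono (Function.support_const_smul_subset r (f e))).trans (hf e).2.2⟩

theorem testFunctions_spec {G : MetricGraph V E} {d : ℕ} {f : E → ℝ → Vec d}
    (hf : f ∈ testFunctions G d) (e : E) :
    ContDiff ℝ ∞ (f e) ∧ HasCompactSupport (f e) ∧ tsupport (f e) ⊆ G.inner e :=
  hf e

namespace SturmLiouville

variable {G : MetricGraph V E} {d : ℕ} (c : SturmLiouville G d)

/-- The quasi-derivative `f^[1] = P f' + Q f`. -/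
def quasiDeriv (f : E → ℝ → Vec d) (e : E) (t : ℝ) : Vec d :=
  c.P e t (deriv (f e) t) + c.Q e t (f e t)

/-- The differential expression `ℓ f = -(P f' + Q f)' + Qᵀ f' + R f`. -/
def expr (f : E → ℝ → Vec d) (e : E) (t : ℝ) : Vec d :=
  -deriv (c.quasiDeriv f e) t + (c.Q e t).adjoint (deriv (f e) t) + c.R e t (f e t)

theorem eventually_zero {f : ℝ → Vec d} {t : ℝ} (ht : t ∉ tsupport f) : f =ᶠ[𝓝 t] 0 :=
  notMem_tsupport_iff_eventuallyEq.1 ht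

theorem quasiDeriv_eventually_zero {f : E → ℝ → Vec d} {e : E} {t : ℝ}
    (ht : t ∉ tsupport (f e)) : c.quasiDeriv f e =ᶠ[𝓝 t] 0 := by
  have h := eventually_zero ht
  filter_upwards [h, h.deriv] with s hs hs'
  simp [quasiDeriv, hs, hs']

theorem expr_eventually_zero {f : E → ℝ → Vec d} {e : E} {t : ℝ}
    (ht : t ∉ tsupport (f e)) : c.expr f e =ᶠ[𝓝 t] 0 := by
  have h := eventually_zero ht
  filter_upwards [h, h.deriv, (c.quasiDeriv_eventually_zero ht).deriv] with s hs hs' hq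
  simp [expr, hs, hs', hq]

theorem edge_mem_nhds {e : E} {t : ℝ} (ht : t ∈ G.inner e) : G.edge e ∈ 𝓝 t :=
  mem_of_superset ((G.isOpen_inner e).mem_nhds ht) (G.inner_subset_edge e)

theorem quasiDeriv_contDiffAt {f : E → ℝ → Vec d} (hf : f ∈ testFunctions G d) (e : E) (t : ℝ) :
    ContDiffAt ℝ 1 (c.quasiDeriv f e) t := by
  by_cases ht : t ∈ tsupport (f e)
  · have hm := edge_mem_nhds ((testFunctions_spec hf e).2.2 ht)
    have hP := (c.contDiffOn_P e).contDiffAt hm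
    have hQ := (c.contDiffOn_Q e).contDiffAt hm
    have h1 : ContDiffAt ℝ 1 (f e) t := ((testFunctions_spec hf e).1.of_le (by exact_mod_cast le_top)).contDiffAt
    have h2 : ContDiffAt ℝ 1 (deriv (f e)) t := by
      have h3 : ContDiff ℝ (1 + 1) (f e) := (testFunctions_spec hf e).1.of_le (by
        rw [one_add_one_eq_two]; exact WithTop.coe_le_coe.2 le_top)
      exact (contDiff_succ_iff_deriv.1 h3).2.2.contDiffAt
    exact (hP.clm_apply h2).add (hQ.clm_apply h1)
  · exact contDiffAt_const.congr_of_eventuallyEq (c.quasiDeriv_eventually_zero ht)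

theorem continuous_expr {f : E → ℝ → Vec d} (hf : f ∈ testFunctions G d) (e : E) :
    Continuous (c.expr f e) := by
  have hq : ContDiff ℝ 1 (c.quasiDeriv f e) :=
    contDiff_iff_contDiffAt.2 (c.quasiDeriv_contDiffAt hf e)
  rw [continuous_iff_continuousAt]
  intro t
  by_cases ht : t ∈ tsupport (f e)
  · have hm := edge_mem_nhds ((testFunctions_spec hf e).2.2 ht)
    have hQ := ((c.contDiffOn_Q e).contDiffAt hm).continuousAt
    have hR := (c.continuousOn_R e).continuousAt hm
    have h1 := ((testFunctions_spec hf e).1.continuous).continuousAt (x := t)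
    have h2 := ((testFunctions_spec hf e).1.continuous_deriv (by simp)).continuousAt (x := t)
    have h3 := (hq.continuous_deriv le_rfl).continuousAt (x := t)
    have hQ' : ContinuousAt (fun s => (c.Q e s).adjoint) t :=
      ContinuousAt.comp (g := ContinuousLinearMap.adjoint)
        (LinearIsometryEquiv.continuous _).continuousAt hQ
    exact (h3.neg.add (hQ'.clm_apply h2)).add (hR.clm_apply h1)
  · exact continuousAt_const.congr (c.expr_eventually_zero ht).symm

theorem memLp_expr {f : E → ℝ → Vec d} (hf : f ∈ testFunctions G d) (e : E) :
    MemLp (c.expr f e) 2 (volume.restrict (G.inner e)) := by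
  refine ((c.continuous_expr hf e).memLp_of_hasCompactSupport ?_).restrict _
  exact HasCompactSupport.intro (testFunctions_spec hf e).2.1 fun t ht => (c.expr_eventually_zero ht).self_of_nhds

theorem memLp_test {f : E → ℝ → Vec d} (hf : f ∈ testFunctions G d) (e : E) :
    MemLp (f e) 2 (volume.restrict (G.inner e)) :=
  ((testFunctions_spec hf e).1.continuous.memLp_of_hasCompactSupport (testFunctions_spec hf e).2.1).restrict _

theorem expr_add {f g : E → ℝ → Vec d} (hf : f ∈ testFunctions G d) (hg : g ∈ testFunctions G d) :
    c.expr (f + g) = c.expr f + c.expr g := by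
  have hd : ∀ e t, deriv (f e + g e) t = deriv (f e) t + deriv (g e) t := fun e t =>
    deriv_add ((testFunctions_spec hf e).1.differentiable (by simp) t) ((testFunctions_spec hg e).1.differentiable (by simp) t)
  have hq : ∀ e, c.quasiDeriv (f + g) e = c.quasiDeriv f e + c.quasiDeriv g e := fun e => by
    funext t
    simp only [quasiDeriv, hd, Pi.add_apply, map_add]
    abel
  funext e t
  have h := deriv_add ((c.quasiDeriv_contDiffAt hf e t).differentiableAt (by simp))
    ((c.quasiDeriv_contDiffAt hg e t).differentiableAt (by simp))
  simp only [expr, hq, hd, h, Pi.add_apply, map_add]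
  abel

theorem expr_smul (r : ℝ) {f : E → ℝ → Vec d} (hf : f ∈ testFunctions G d) :
    c.expr (r • f) = r • c.expr f := by
  have hd : ∀ e t, deriv (r • f e) t = r • deriv (f e) t := fun e t =>
    deriv_const_smul r ((testFunctions_spec hf e).1.differentiable (by simp) t)
  have hq : ∀ e, c.quasiDeriv (r • f) e = r • c.quasiDeriv f e := fun e => by
    funext t
    simp only [quasiDeriv, hd, Pi.smul_apply, map_smul, smul_add]
  funext e t
  have h := deriv_const_smul r ((c.quasiDeriv_contDiffAt hf e t).differentiableAt (by simp))
  simp only [expr, hq, hd, h, Pi.smul_apply, map_smul, smul_add, smul_neg]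

variable [Fintype E]

/-- The class in `L²(G; ℝ^d)` of a test function. -/
def testToL2 (G : MetricGraph V E) (d : ℕ) : testFunctions G d →ₗ[ℝ] G.L2 d where
  toFun f := WithLp.toLp 2 fun e => (memLp_test f.2 e).toLp (f.1 e)
  map_add' f g := PiLp.ext fun e => MemLp.toLp_add (memLp_test f.2 e) (memLp_test g.2 e)
  map_smul' r f := PiLp.ext fun e => MemLp.toLp_const_smul r (memLp_test f.2 e)

/-- The class in `L²(G; ℝ^d)` of `ℓ f`, for a test function `f`. -/
def exprToL2 : testFunctions G d →ₗ[ℝ] G.L2 d where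
  toFun f := WithLp.toLp 2 fun e => (c.memLp_expr f.2 e).toLp (c.expr f.1 e)
  map_add' f g := PiLp.ext fun e =>
    (MemLp.toLp_congr (c.memLp_expr (f + g).2 e) ((c.memLp_expr f.2 e).add (c.memLp_expr g.2 e))
      (.of_eq (congrFun (c.expr_add f.2 g.2) e))).trans (MemLp.toLp_add (c.memLp_expr f.2 e) (c.memLp_expr g.2 e))
  map_smul' r f := PiLp.ext fun e =>
    (MemLp.toLp_congr (c.memLp_expr (r • f).2 e) ((c.memLp_expr f.2 e).const_smul r)
      (.of_eq (congrFun (c.expr_smul r f.2) e))).trans (MemLp.toLp_const_smul r (c.memLp_expr f.2 e))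

theorem testToL2_injective : Function.Injective (testToL2 G d) := by
  intro f g h
  ext1
  funext e
  have h1 : (memLp_test f.2 e).toLp (f.1 e) = (memLp_test g.2 e).toLp (g.1 e) :=
    congrFun (congrArg WithLp.ofLp h) e
  rw [MemLp.toLp_eq_toLp_iff] at h1
  have h2 := Measure.eqOn_open_of_ae_eq h1 (G.isOpen_inner e)
    (testFunctions_spec f.2 e).1.continuous.continuousOn (testFunctions_spec g.2 e).1.continuous.continuousOn
  funext t
  by_cases ht : t ∈ G.inner e
  · exact h2 ht
  · rw [image_eq_zero_of_notMem_tsupport fun h => ht ((testFunctions_spec f.2 e).2.2 h),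
      image_eq_zero_of_notMem_tsupport fun h => ht ((testFunctions_spec g.2 e).2.2 h)]

/-- The operator `f ↦ ℓ f` in `L²(G; ℝ^d)` with domain the test functions. -/
def preminimal : G.L2 d →ₗ.[ℝ] G.L2 d where
  domain := LinearMap.range (testToL2 G d)
  toFun := c.exprToL2 ∘ₗ (LinearEquiv.ofInjective (testToL2 G d) testToL2_injective).symm

/-- The minimal operator `L` of `ℓ`: the closure of `ℓ` on test functions.  The maximal operator
is its adjoint `L*`. -/
def minimal : G.L2 d →ₗ.[ℝ] G.L2 d := c.preminimal.closure

end SturmLiouville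

end

end QuantumGraph

/-!
The ordinary differential equation enters only through two facts about smooth functions compactly
supported in the interiors of the edges: they are dense in `L²`, and `ℓ` is symmetric on them (the
Lagrange identity `SturmLiouville.hasDerivAt_wronskian`). Hence `A = L` is a closed, densely defined
symmetric operator in a Hilbert space, and everything else is a statement about such operators,
collected in `IsBoundarySetting`.

Since `ker A* ⊆ U` meets `dom A` only in `0`, the kernel of `A` is trivial, and as the range of `A*`
is closed, `A*` is surjective; dually, the range of `A` is the orthogonal complement of `ker A*`
(`exists_apply_eq_of_orthogonal_ker`). Hence `u ∈ U` lies in `ker A*` as soon as `A* u` is orthogonal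
to `ker A*`, which makes `U` finite-dimensional. The subspace `K = p (ker A*)` is just `ker A*` seen
in `U`, and that it is its own annihilator is the same fact. The form `ρ` is nondegenerate because
`A` is closed. For `Λ_D`, isotropy is a limit of the symmetry of the form of `A`,
and maximality follows because `A* + s` maps the Friedrichs domain onto the whole space when `s` is
large (`exists_friedrichs_solution`, by minimizing the shifted form).

The heart of the matter is that, for every Lagrangian `Λ`,
`iMor(A_Λ) = iMor(A_F) + ι(K, Λ, Λ_D)`, with `A_F` the Friedrichs extension
(`morseIndex_extension`). Extend the form of `A_Λ` to `dom A_F × Λ`. This does not change its Morse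
index, as `dom A` is dense in `dom A_F` for the form of `A` (`posIndex_eq_of_dense`). The subspace
`dom A_F × 0` has finite codimension and its orthogonal consists of the pairs `(v, l)` with
`v + l ∈ ker A*`, on which the form is, up to sign, `Q(K, Λ; Λ_D)`. The index of a form is the
index on a subspace of finite codimension plus the index on its orthogonal plus a correction for
their intersection (`posIndex_eq_add`), which here is `dim K ∩ Λ_D - dim K ∩ Λ ∩ Λ_D`.

Subtracting the formula for `Λ₀` from that for `Λ₁` leaves `ι(K, Λ₁, Λ_D) - ι(K, Λ₀, Λ_D)`, which is
rewritten by the cocycle identity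
`ι(α, β, δ) + ι(β, γ, δ) = ι(α, γ, δ) + ι(α, β, γ)` (`tripleIndex_cocycle`). The latter is proved
by choosing a Lagrangian `η` transversal to `α`, `β` and `γ`, for which `posIndex_eq_add` gives
`n₊ Q(α, β; η) + n₊ Q(β, γ; η) = n₊ Q(α, γ; η) + ι(α, β, γ)`.
-/

namespace QuantumGraph

open MeasureTheory Filter Topology

/-! ### Positive indices of quadratic forms -/

section PosIndex

variable {X : Type*} [AddCommGroup X] [Module ℝ X]

theorem finrank_le_posIndex {q : X → ℝ} (W : Submodule ℝ X) [hW : FiniteDimensional ℝ W]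
    (h : ∀ x ∈ W, x ≠ 0 → 0 < q x) : (Module.finrank ℝ W : ℕ∞) ≤ posIndex q :=
  le_iSup_of_le W (le_iSup_of_le hW (le_iSup_of_le h le_rfl))

theorem posIndex_le {q : X → ℝ} {m : ℕ∞} (h : ∀ (W : Submodule ℝ X), FiniteDimensional ℝ W →
    (∀ x ∈ W, x ≠ 0 → 0 < q x) → (Module.finrank ℝ W : ℕ∞) ≤ m) : posIndex q ≤ m :=
  iSup_le fun W => iSup_le fun hW => iSup_le fun hq => h W hW hq

theorem exists_posDef_finrank_eq {q : X → ℝ} (h : posIndex q ≠ ⊤) :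
    ∃ W : Submodule ℝ X, FiniteDimensional ℝ W ∧ (∀ x ∈ W, x ≠ 0 → 0 < q x) ∧
      posIndex q = (Module.finrank ℝ W : ℕ∞) := by
  obtain ⟨n, hn⟩ := ENat.ne_top_iff_exists.1 h
  by_contra! hcon
  have hlt : ∀ W : Submodule ℝ X, FiniteDimensional ℝ W → (∀ x ∈ W, x ≠ 0 → 0 < q x) →
      Module.finrank ℝ W < n := fun W h1 h2 => by
    have h3 := lt_of_le_of_ne (finrank_le_posIndex W h2) (hcon W h1 h2).symm
    rw [← hn] at h3
    exact_mod_cast h3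
  have hpos : 0 < n :=
    (Nat.zero_le _).trans_lt (hlt ⊥ inferInstance fun x hx h0 => absurd ((Submodule.mem_bot ℝ).1 hx) h0)
  have hle : posIndex q ≤ ((n - 1 : ℕ) : ℕ∞) :=
    posIndex_le fun W h1 h2 => by exact_mod_cast Nat.le_sub_one_of_lt (hlt W h1 h2)
  rw [← hn] at hle
  have : n ≤ n - 1 := by exact_mod_cast hle
  omega

variable {X' : Type*} [AddCommGroup X'] [Module ℝ X']

theorem posIndex_comp_le {q : X' → ℝ} (hq : q 0 = 0) (f : X →ₗ[ℝ] X') :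
    posIndex (fun x => q (f x)) ≤ posIndex q := by
  refine posIndex_le fun W hW h => ?_
  have hinj : Function.Injective (f.domRestrict W) := by
    refine (injective_iff_map_eq_zero _).2 fun x hx => ?_
    by_contra hne
    have h1 := h x x.2 fun h0 => hne (Subtype.ext h0)
    have h2 : f x = 0 := hx
    rw [h2, hq] at h1
    exact lt_irrefl _ h1
  have hr : Module.finrank ℝ (W.map f) = Module.finrank ℝ W := by
    rw [← LinearMap.finrank_range_of_inj hinj, LinearMap.range_domRestrict]
  rw [← hr]
  refine finrank_le_posIndex _ ?_
  rintro _ ⟨x, hx, rfl⟩ hne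
  exact h x hx fun h0 => hne (by simp [h0])

/-- The positive index does not change under pullback along a surjection. -/
theorem posIndex_comp_of_surjective {q : X' → ℝ} (hq : q 0 = 0) {f : X →ₗ[ℝ] X'}
    (hf : Function.Surjective f) : posIndex (fun x => q (f x)) = posIndex q := by
  refine le_antisymm (posIndex_comp_le hq f) ?_
  obtain ⟨g, hg⟩ := f.exists_rightInverse_of_surjective (LinearMap.range_eq_top.2 hf)
  have h := posIndex_comp_le (q := fun x => q (f x)) (by simp [hq]) g
  simpa [← LinearMap.comp_apply, hg] using h

/-- A quadratic form which is nonpositive on a subspace of finite codimension has positive index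
at most that codimension. -/
theorem posIndex_le_finrank {T : Type*} [AddCommGroup T] [Module ℝ T] [FiniteDimensional ℝ T]
    {q : X → ℝ} (g : X →ₗ[ℝ] T) (h : ∀ x, g x = 0 → q x ≤ 0) :
    posIndex q ≤ (Module.finrank ℝ T : ℕ∞) := by
  refine posIndex_le fun W hW hpos => ?_
  have hinj : Function.Injective (g.domRestrict W) := by
    refine (injective_iff_map_eq_zero _).2 fun x hx => ?_
    by_contra hne
    exact (h x hx).not_gt (hpos x x.2 fun h0 => hne (Subtype.ext h0))
  exact_mod_cast LinearMap.finrank_le_finrank_of_injective hinj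

theorem posIndex_ne_top [FiniteDimensional ℝ X] (q : X → ℝ) (hq : q 0 = 0) : posIndex q ≠ ⊤ :=
  ne_top_of_le_ne_top (ENat.natCast_ne_top (Module.finrank ℝ X))
    (posIndex_le_finrank LinearMap.id fun x hx => by
      rw [LinearMap.id_apply] at hx
      rw [hx, hq])

variable {B : LinearMap.BilinForm ℝ X}

/-- A functional on a positive definite finite-dimensional subspace is represented by a vector. -/
theorem exists_repr_of_posDef {P : Submodule ℝ X} [FiniteDimensional ℝ P]
    (hP : ∀ x ∈ P, x ≠ 0 → 0 < B x x) (φ : P →ₗ[ℝ] ℝ) : ∃ w ∈ P, ∀ p : P, B w p = φ p := by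
  have hinj : Function.Injective (B.restrict P) := by
    refine (injective_iff_map_eq_zero _).2 fun x hx => ?_
    by_contra hne
    have h1 := hP x x.2 fun h0 => hne (Subtype.ext h0)
    have h2 : B x x = 0 := LinearMap.congr_fun hx x
    exact h1.ne' h2
  obtain ⟨w, hw⟩ := (LinearMap.injective_iff_surjective_of_finrank_eq_finrank
    (Subspace.dual_finrank_eq (K := ℝ) (V := P)).symm).1 hinj φ
  exact ⟨w, w.2, fun p => LinearMap.congr_fun hw p⟩

theorem exists_sub_orthogonal {P : Submodule ℝ X} [FiniteDimensional ℝ P]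
    (hP : ∀ x ∈ P, x ≠ 0 → 0 < B x x) (x : X) : ∃ p ∈ P, ∀ p' ∈ P, B (x - p) p' = 0 := by
  obtain ⟨w, hw, h⟩ := exists_repr_of_posDef hP ((B x).domRestrict P)
  refine ⟨w, hw, fun p hp => ?_⟩
  have := h ⟨p, hp⟩
  simp only [LinearMap.domRestrict_apply] at this
  simp [this]

variable (hB : ∀ x y, B x y = B y x)
include hB

theorem posDef_sup {P W : Submodule ℝ X} (hP : ∀ x ∈ P, x ≠ 0 → 0 < B x x)
    (hW : ∀ x ∈ W, x ≠ 0 → 0 < B x x) (h : ∀ x ∈ P, ∀ y ∈ W, B x y = 0) :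
    (∀ x ∈ P ⊔ W, x ≠ 0 → 0 < B x x) ∧ Disjoint P W := by
  constructor
  · intro x hx hne
    obtain ⟨p, hp, w, hw, rfl⟩ := Submodule.mem_sup.1 hx
    have e : B (p + w) (p + w) = B p p + B w w := by
      simp [h p hp w hw, hB w p]
    rw [e]
    by_cases h0 : p = 0
    · subst h0
      have := hW w hw (by simpa using hne)
      simpa using this
    · have h1 := hP p hp h0
      by_cases h2 : w = 0
      · simpa [h2] using h1
      · linarith [hW w hw h2]
  · rw [Submodule.disjoint_def]
    intro x hx hx'
    by_contra hne
    exact (hP x hx hne).ne' (h x hx x hx')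

/-- If the index is finite, a positive definite subspace extends to one whose orthogonal is
nonpositive. -/
theorem exists_maximal_posDef (hfin : posIndex (fun x => B x x) ≠ ⊤) (W : Submodule ℝ X)
    [FiniteDimensional ℝ W] (hW : ∀ x ∈ W, x ≠ 0 → 0 < B x x) :
    ∃ P : Submodule ℝ X, W ≤ P ∧ FiniteDimensional ℝ P ∧ (∀ x ∈ P, x ≠ 0 → 0 < B x x) ∧
      ∀ x, (∀ p ∈ P, B x p = 0) → B x x ≤ 0 := by
  obtain ⟨n, hn⟩ := ENat.ne_top_iff_exists.1 hfin
  let S : Set ℕ := {k | ∃ P : Submodule ℝ X, W ≤ P ∧ FiniteDimensional ℝ P ∧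
    (∀ x ∈ P, x ≠ 0 → 0 < B x x) ∧ Module.finrank ℝ P = k}
  have hS : S.Nonempty := ⟨_, W, le_rfl, inferInstance, hW, rfl⟩
  have hbdd : BddAbove S := ⟨n, by
    rintro k ⟨P, -, hfd, hP, rfl⟩
    have := finrank_le_posIndex P hP
    rw [← hn] at this
    exact_mod_cast this⟩
  obtain ⟨P, hWP, hfd, hP, hk⟩ := Nat.sSup_mem hS hbdd
  refine ⟨P, hWP, hfd, hP, fun x hx => ?_⟩
  by_contra! hpos
  have hx0 : x ≠ 0 := by rintro rfl; simp at hpos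
  have hspan : ∀ y ∈ Submodule.span ℝ {x}, y ≠ 0 → 0 < B y y := by
    intro y hy hne
    obtain ⟨r, rfl⟩ := Submodule.mem_span_singleton.1 hy
    have hr : r ≠ 0 := by rintro rfl; simp at hne
    have : 0 < r * r * B x x := mul_pos (mul_self_pos.2 hr) hpos
    simpa [mul_assoc] using this
  obtain ⟨h1, h2⟩ := posDef_sup hB hP hspan fun p hp y hy => by
    obtain ⟨r, rfl⟩ := Submodule.mem_span_singleton.1 hy
    simp [hB p x, hx p hp]
  have hle : Module.finrank ℝ ↥(P ⊔ Submodule.span ℝ {x}) ≤ sSup S :=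
    le_csSup hbdd ⟨_, hWP.trans le_sup_left, inferInstance, h1, rfl⟩
  have h3 := Submodule.finrank_sup_add_finrank_inf_eq P (Submodule.span ℝ {x})
  rw [h2.eq_bot, finrank_bot, finrank_span_singleton hx0] at h3
  omega

/-- An isotropic vector of a nonpositive subspace is orthogonal to the subspace. -/
theorem eq_zero_of_nonpos {N : Submodule ℝ X} (hN : ∀ x ∈ N, B x x ≤ 0) {c x : X} (hc : c ∈ N)
    (hcc : B c c = 0) (hx : x ∈ N) : B c x = 0 := by
  by_contra hne
  have key : ∀ t : ℝ, 2 * t * B c x + B x x ≤ 0 := fun t => by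
    have := hN (t • c + x) (N.add_mem (N.smul_mem t hc) hx)
    simp only [map_add, map_smul, LinearMap.add_apply, LinearMap.smul_apply, smul_eq_mul, hcc,
      hB x c] at this
    linarith
  have h1 := key ((1 - B x x) / (2 * B c x))
  have h2 : 2 * ((1 - B x x) / (2 * B c x)) * B c x = 1 - B x x := by
    field_simp
  linarith

/-- The lower bound in `posIndex_eq_add`: a subspace `C` which is isotropic, orthogonal to a
positive definite `W` and free of radical vectors contributes its dimension.  In a maximal positive
definite `P ⊇ W` the pairing of `C` with `P` has no kernel, and it annihilates `W`. -/
theorem finrank_add_le_posIndex (W C : Submodule ℝ X) [FiniteDimensional ℝ W]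
    [FiniteDimensional ℝ C] (hW : ∀ x ∈ W, x ≠ 0 → 0 < B x x)
    (hCW : ∀ c ∈ C, ∀ w ∈ W, B c w = 0) (hCC : ∀ c ∈ C, B c c = 0)
    (hC : ∀ c ∈ C, (∀ x, B c x = 0) → c = 0) :
    ((Module.finrank ℝ W + Module.finrank ℝ C : ℕ) : ℕ∞) ≤ posIndex (fun x => B x x) := by
  by_cases hfin : posIndex (fun x => B x x) = ⊤
  · rw [hfin]; exact le_top
  obtain ⟨P, hWP, hfd, hP, hmax⟩ := exists_maximal_posDef hB hfin W hW
  let ψ : C →ₗ[ℝ] Module.Dual ℝ P := B.compl₁₂ C.subtype P.subtype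
  have hψ : Function.Injective ψ := by
    refine (injective_iff_map_eq_zero _).2 fun c hc => ?_
    have hcP : ∀ p ∈ P, B c p = 0 := fun p hp => LinearMap.congr_fun hc ⟨p, hp⟩
    refine Subtype.ext (hC c c.2 fun x => ?_)
    obtain ⟨p, hp, hxp⟩ := exists_sub_orthogonal hP x
    let N : Submodule ℝ X := B.orthogonal P
    have hN : ∀ y ∈ N, B y y ≤ 0 := fun y hy => hmax y fun p hp => by rw [hB]; exact hy p hp
    have h0 := eq_zero_of_nonpos hB hN (c := c) (x := x - p)
      (fun p hp => by rw [hB]; exact hcP p hp) (hCC c c.2)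
      (fun p hp => by rw [hB]; exact hxp p hp)
    rw [map_sub, hcP p hp, sub_zero] at h0
    exact h0
  let W' : Submodule ℝ P := W.comap P.subtype
  have hr : LinearMap.range ψ ≤ W'.dualAnnihilator := by
    rintro _ ⟨c, rfl⟩
    rw [Submodule.mem_dualAnnihilator]
    exact fun w hw => hCW c c.2 w hw
  have h1 := Submodule.finrank_mono hr
  rw [LinearMap.finrank_range_of_inj hψ] at h1
  have h2 := Subspace.finrank_add_finrank_dualAnnihilator_eq W'
  have h3 : Module.finrank ℝ W' = Module.finrank ℝ W :=
    (Submodule.comapSubtypeEquivOfLe hWP).finrank_eq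
  refine le_trans ?_ (finrank_le_posIndex P hP)
  exact_mod_cast by omega

/-- Additivity of the positive index.  Let `Y = ker f` have finite codimension, let `E` be
orthogonal to `Y`, and let `C ⊆ Y ∩ E` contain no vector of the radical.  If the codimension of
`Y + E` is at most `dim C`, then the positive index is the sum of those of `Y` and `E` and of
`dim C`. -/
theorem posIndex_eq_add {T : Type*} [AddCommGroup T] [Module ℝ T] [FiniteDimensional ℝ T]
    (f : X →ₗ[ℝ] T) (E C : Submodule ℝ X) [FiniteDimensional ℝ C]
    (hE : ∀ y, f y = 0 → ∀ e ∈ E, B y e = 0) (hCE : C ≤ E) (hCf : ∀ c ∈ C, f c = 0)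
    (hC : ∀ c ∈ C, (∀ x, B c x = 0) → c = 0)
    (hdim : Module.finrank ℝ (LinearMap.range f) ≤
      Module.finrank ℝ (E.map f) + Module.finrank ℝ C) :
    posIndex (fun x => B x x) = posIndex (fun y : LinearMap.ker f => B y y) +
      posIndex (fun e : E => B e e) + (Module.finrank ℝ C : ℕ∞) := by
  have hYle : posIndex (fun y : LinearMap.ker f => B y y) ≤ posIndex (fun x => B x x) :=
    posIndex_comp_le (q := fun x => B x x) (by simp) (LinearMap.ker f).subtype
  have hEle : posIndex (fun y : E => B y y) ≤ posIndex (fun x => B x x) :=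
    posIndex_comp_le (q := fun x => B x x) (by simp) E.subtype
  by_cases hY : posIndex (fun y : LinearMap.ker f => B y y) = ⊤
  · rw [hY, top_le_iff] at hYle
    simp [hY, hYle]
  by_cases hEt : posIndex (fun y : E => B y y) = ⊤
  · rw [hEt, top_le_iff] at hEle
    simp [hEt, hEle]
  let BY := B.restrict (LinearMap.ker f)
  let BE := B.restrict E
  have hBY : ∀ x y, BY x y = BY y x := fun x y => hB x y
  have hBE : ∀ x y, BE x y = BE y x := fun x y => hB x y
  obtain ⟨P₁, h₁fd, hP₁, hn₁⟩ := exists_posDef_finrank_eq hY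
  obtain ⟨P₂, h₂fd, hP₂, hn₂⟩ := exists_posDef_finrank_eq hEt
  apply le_antisymm
  · -- the index drops by at most `dim C` on `Y + E`, where it is additive
    obtain ⟨Q₁, -, h₁fd', hQ₁, hm₁⟩ := exists_maximal_posDef hBY hY P₁ hP₁
    obtain ⟨Q₂, -, h₂fd', hQ₂, hm₂⟩ := exists_maximal_posDef hBE hEt P₂ hP₂
    let S : Submodule ℝ (LinearMap.range f) := (E.map f).comap (LinearMap.range f).subtype
    have : FiniteDimensional ℝ (Module.Dual ℝ Q₁) := Subspace.instModuleDualFiniteDimensional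
    have : FiniteDimensional ℝ (Module.Dual ℝ Q₂) := Subspace.instModuleDualFiniteDimensional
    have : FiniteDimensional ℝ (Module.Dual ℝ Q₁ × Module.Dual ℝ Q₂) := Module.Finite.prod
    let g : X →ₗ[ℝ] (Module.Dual ℝ Q₁ × Module.Dual ℝ Q₂) × (LinearMap.range f ⧸ S) :=
      ((B.compl₂ ((LinearMap.ker f).subtype ∘ₗ Q₁.subtype)).prod
        (B.compl₂ (E.subtype ∘ₗ Q₂.subtype))).prod (S.mkQ ∘ₗ f.rangeRestrict)
    have hS : Module.finrank ℝ S = Module.finrank ℝ (E.map f) :=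
      (Submodule.comapSubtypeEquivOfLe LinearMap.map_le_range).finrank_eq
    have hSq := S.finrank_quotient_add_finrank
    refine (posIndex_le_finrank g fun x hx => ?_).trans ?_
    · have hx1 : ∀ w : Q₁, B x w = 0 := fun w =>
        LinearMap.congr_fun (congrArg (fun z => z.1.1) hx) w
      have hx2 : ∀ w : Q₂, B x w = 0 := fun w =>
        LinearMap.congr_fun (congrArg (fun z => z.1.2) hx) w
      have hx3 : S.mkQ (f.rangeRestrict x) = 0 := congrArg (fun z => z.2) hx
      rw [Submodule.mkQ_apply, Submodule.Quotient.mk_eq_zero] at hx3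
      obtain ⟨e, he, hfe⟩ : ∃ e ∈ E, f e = f x := hx3
      obtain ⟨y, rfl⟩ : ∃ y, x = y + e := ⟨x - e, by abel⟩
      have hy : f y = 0 := by simpa using hfe
      have hye : B y e = 0 := hE y hy e he
      have hyy : BY ⟨y, hy⟩ ⟨y, hy⟩ ≤ 0 := hm₁ _ fun p hp => by
        have h1 := hx1 ⟨p, hp⟩
        have h2 : B e p = 0 := by rw [hB]; exact hE p p.2 e he
        rw [map_add, LinearMap.add_apply] at h1
        change B y p = 0
        simp only [h2, add_zero] at h1
        exact h1
      have hee : BE ⟨e, he⟩ ⟨e, he⟩ ≤ 0 := hm₂ _ fun p hp => by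
        have h1 := hx2 ⟨p, hp⟩
        have h2 : B y p = 0 := hE y hy p p.2
        rw [map_add, LinearMap.add_apply] at h1
        change B e p = 0
        simp only [h2, zero_add] at h1
        exact h1
      change B y y ≤ 0 at hyy
      change B e e ≤ 0 at hee
      simp only [map_add, LinearMap.add_apply, hye, hB e y]
      linarith
    · rw [Module.finrank_prod, Module.finrank_prod, Subspace.dual_finrank_eq,
        Subspace.dual_finrank_eq]
      have i1 := finrank_le_posIndex (q := fun y : LinearMap.ker f => B y y) Q₁ hQ₁
      have i2 := finrank_le_posIndex (q := fun y : E => B y y) Q₂ hQ₂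
      rw [hn₁] at i1 ⊢
      rw [hn₂] at i2 ⊢
      have i1' : Module.finrank ℝ Q₁ ≤ Module.finrank ℝ P₁ := by exact_mod_cast i1
      have i2' : Module.finrank ℝ Q₂ ≤ Module.finrank ℝ P₂ := by exact_mod_cast i2
      exact_mod_cast by omega
  · let W₁ := P₁.map (LinearMap.ker f).subtype
    let W₂ := P₂.map E.subtype
    have hW₁ : ∀ x ∈ W₁, x ≠ 0 → 0 < B x x := by
      rintro _ ⟨x, hx, rfl⟩ hne
      exact hP₁ x hx fun h0 => hne (by simp [h0])
    have hW₂ : ∀ x ∈ W₂, x ≠ 0 → 0 < B x x := by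
      rintro _ ⟨x, hx, rfl⟩ hne
      exact hP₂ x hx fun h0 => hne (by simp [h0])
    obtain ⟨h1, h2⟩ := posDef_sup hB hW₁ hW₂ (by
      rintro _ ⟨x, hx, rfl⟩ _ ⟨y, hy, rfl⟩
      exact hE x x.2 y y.2)
    have h3 := Submodule.finrank_sup_add_finrank_inf_eq W₁ W₂
    rw [h2.eq_bot, finrank_bot] at h3
    have e1 : Module.finrank ℝ W₁ = Module.finrank ℝ P₁ := Submodule.finrank_map_subtype_eq _ _
    have e2 : Module.finrank ℝ W₂ = Module.finrank ℝ P₂ := Submodule.finrank_map_subtype_eq _ _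
    have h4 := finrank_add_le_posIndex hB (W₁ ⊔ W₂) C h1 (fun c hc w hw => by
      obtain ⟨w₁, ⟨a, ha, rfl⟩, w₂, ⟨b, hb, rfl⟩, rfl⟩ := Submodule.mem_sup.1 hw
      rw [Submodule.subtype_apply, Submodule.subtype_apply, map_add, hE c (hCf c hc) _ b.2, hB c,
        add_zero]
      exact hE a a.2 c (hCE hc)) (fun c hc => hE c (hCf c hc) c (hCE hc)) hC
    refine le_trans (le_of_eq ?_) h4
    rw [hn₁, hn₂]
    exact_mod_cast by omega

/-- The positive index may be computed on a subspace `Z` that is dense for the form. -/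
theorem posIndex_eq_of_dense (Z : Submodule ℝ X)
    (hZ : ∀ x, ∃ z : ℕ → Z, (∀ w, Tendsto (fun n => B (z n) w) atTop (𝓝 (B x w))) ∧
      Tendsto (fun n => B (z n) (z n)) atTop (𝓝 (B x x))) :
    posIndex (fun x => B x x) = posIndex (fun z : Z => B z z) := by
  have hle : posIndex (fun z : Z => B z z) ≤ posIndex (fun x => B x x) :=
    posIndex_comp_le (q := fun x => B x x) (by simp) Z.subtype
  refine le_antisymm ?_ hle
  by_cases hfin : posIndex (fun z : Z => B z z) = ⊤
  · rw [hfin]; exact le_top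
  obtain ⟨P', -, hfd, hP', hmax⟩ := exists_maximal_posDef (B := B.restrict Z)
    (fun x y => hB x y) hfin ⊥ fun x hx h0 => absurd ((Submodule.mem_bot ℝ).1 hx) h0
  let P := P'.map Z.subtype
  have hP : ∀ x ∈ P, x ≠ 0 → 0 < B x x := by
    rintro _ ⟨x, hx, rfl⟩ hne
    exact hP' x hx fun h0 => hne (by simp [h0])
  refine (posIndex_le_finrank (B.compl₂ P.subtype) fun x hx => ?_).trans ?_
  · have hxP : ∀ p ∈ P, B x p = 0 := fun p hp => LinearMap.congr_fun hx ⟨p, hp⟩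
    obtain ⟨z, hz, hzz⟩ := hZ x
    choose p hpP hp using fun n => exists_sub_orthogonal hP (z n : X)
    -- the components `p n` of `z n` in `P` contribute `B (z n) (p n) → 0`
    let b := Module.finBasis ℝ P
    choose w hwP hw using fun i => exists_repr_of_posDef hP (b.coord i)
    have hexp : ∀ n, B (z n) (p n) = ∑ i, B (z n) (w i) * B (z n) (b i) := fun n => by
      have h1 : (p n) = ∑ i, B (z n) (w i) • (b i : X) := by
        have h2 := congrArg P.subtype (b.sum_repr ⟨p n, hpP n⟩)
        simp only [map_sum, map_smul, Submodule.subtype_apply] at h2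
        rw [← h2]
        refine Finset.sum_congr rfl fun i _ => ?_
        have h3 := hw i ⟨p n, hpP n⟩
        have h4 := hp n (w i) (hwP i)
        rw [map_sub, LinearMap.sub_apply, sub_eq_zero] at h4
        rw [h4, hB, h3, Module.Basis.coord_apply]
      conv_lhs => rw [h1]
      simp [map_sum]
    have hlim : Tendsto (fun n => B (z n) (p n)) atTop (𝓝 0) := by
      simp_rw [hexp]
      have : Tendsto (fun n => ∑ i, B (z n) (w i) * B (z n) (b i)) atTop
          (𝓝 (∑ i, B x (w i) * B x (b i))) :=
        tendsto_finsetSum _ fun i _ => (hz _).mul (hz _)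
      simpa [fun i => hxP (w i) (hwP i)] using this
    have hneg : ∀ n, B (z n) (z n) - B (z n) (p n) ≤ 0 := fun n => by
      obtain ⟨p', hp', hpe⟩ := hpP n
      have h1 : B (z n - p n) (z n - p n) ≤ 0 := by
        have := hmax (z n - p') fun r hr => by
          have h := hp n r ⟨r, hr, rfl⟩
          rw [← hpe] at h
          exact h
        rw [← hpe]
        exact this
      have h2 := hp n (p n) (hpP n)
      simp only [map_sub, LinearMap.sub_apply] at h1 h2
      rw [hB (p n) (z n)] at h1
      linarith
    have := le_of_tendsto (hzz.sub hlim) (Eventually.of_forall hneg)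
    simpa using this
  · rw [Subspace.dual_finrank_eq, Submodule.finrank_map_subtype_eq]
    exact finrank_le_posIndex (q := fun z : Z => B z z) P' hP'

end PosIndex

/-! ### Lagrangian subspaces and the triple index -/

section Symplectic

variable {X : Type*} [AddCommGroup X] [Module ℝ X] {σ : LinearMap.BilinForm ℝ X}

theorem IsLagrangian.apply_eq_zero {μ : Submodule ℝ X} (h : IsLagrangian σ μ) {x y : X}
    (hx : x ∈ μ) (hy : y ∈ μ) : σ x y = 0 := by
  rw [← h] at hy
  exact hy x hx

theorem IsLagrangian.mem {μ : Submodule ℝ X} (h : IsLagrangian σ μ) {x : X}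
    (hx : ∀ m ∈ μ, σ m x = 0) : x ∈ μ := by
  rw [← h]
  exact hx

theorem orthogonal_sup (μ ν : Submodule ℝ X) :
    σ.orthogonal (μ ⊔ ν) = σ.orthogonal μ ⊓ σ.orthogonal ν := by
  refine le_antisymm (le_inf (LinearMap.BilinForm.orthogonal_le le_sup_left)
    (LinearMap.BilinForm.orthogonal_le le_sup_right)) fun x hx y hy => ?_
  obtain ⟨u, hu, v, hv, rfl⟩ := Submodule.mem_sup.1 hy
  have h1 : σ u x = 0 := hx.1 u hu
  have h2 : σ v x = 0 := hx.2 v hv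
  rw [map_add, LinearMap.add_apply, h1, h2, add_zero]

theorem tripleForm_zero {α β γ : Submodule ℝ X} (hβ : IsLagrangian σ β)
    (hγ : IsLagrangian σ γ) : tripleForm σ α β γ 0 = 0 := by
  rw [tripleForm_eq hβ hγ 0 β.zero_mem (by simp)]
  simp

/-- The positive index of `Q(α, β; γ)`, computed in any parametrization `g` of `α ∩ (β + γ)`. -/
theorem posIndex_tripleForm_eq {Z : Type*} [AddCommGroup Z] [Module ℝ Z] {α β γ : Submodule ℝ X}
    (hβ : IsLagrangian σ β) (hγ : IsLagrangian σ γ) (g : Z →ₗ[ℝ] X) (b : Z → X) (q : Z → ℝ)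
    (hg : ∀ z, g z ∈ α) (hsurj : ∀ x ∈ α ⊓ (β ⊔ γ), ∃ z, g z = x) (hb : ∀ z, b z ∈ β)
    (hgb : ∀ z, g z + b z ∈ γ) (hq : ∀ z, q z = σ (g z) (b z)) :
    posIndex (tripleForm σ α β γ) = posIndex q := by
  have hmem : ∀ z, g z ∈ α ⊓ (β ⊔ γ) := fun z => ⟨hg z, Submodule.mem_sup.2
    ⟨-b z, β.neg_mem (hb z), g z + b z, hgb z, by abel⟩⟩
  rw [← posIndex_comp_of_surjective (tripleForm_zero hβ hγ)
    (f := g.codRestrict _ hmem) fun x => by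
      obtain ⟨z, hz⟩ := hsurj x x.2
      exact ⟨z, Subtype.ext hz⟩]
  refine congrArg posIndex (funext fun z => ?_)
  rw [tripleForm_eq hβ hγ _ (hb z) (hgb z), hq]
  rfl

variable [FiniteDimensional ℝ X] (hσ : σ.IsAlt) (hnd : σ.Nondegenerate)
include hσ hnd

/-- Finitely many Lagrangian subspaces have a common Lagrangian complement.  A maximal isotropic
`η` transversal to all of them is Lagrangian: otherwise, as `ℝ` is infinite, some vector of the
annihilator of `η` lies in no `η + α i`. -/
theorem exists_isLagrangian_inf_eq_bot {ι : Type*} [Finite ι] [Nonempty ι]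
    (α : ι → Submodule ℝ X) (hα : ∀ i, IsLagrangian σ (α i)) :
    ∃ η, IsLagrangian σ η ∧ ∀ i, α i ⊓ η = ⊥ := by
  let S : Set (Submodule ℝ X) := {η | η ≤ σ.orthogonal η ∧ ∀ i, α i ⊓ η = ⊥}
  obtain ⟨η, ⟨hiso, htr⟩, hmax⟩ := wellFounded_gt.has_min S ⟨⊥, bot_le, fun i => inf_bot_eq _⟩
  refine ⟨η, le_antisymm ?_ hiso, htr⟩
  by_contra hlt
  have hN : ∀ i, (η ⊔ α i).comap (σ.orthogonal η).subtype ≠ ⊤ := fun i htop => by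
    rw [Submodule.comap_subtype_eq_top] at htop
    refine hlt fun x hx => ?_
    obtain ⟨h, hh, a, ha, rfl⟩ := Submodule.mem_sup.1 (htop hx)
    have ha' : a ∈ σ.orthogonal η := by
      simpa using (σ.orthogonal η).sub_mem hx (hiso hh)
    refine η.add_mem hh ?_
    rw [← LinearMap.BilinForm.orthogonal_orthogonal hnd hσ.isRefl η]
    intro y hy
    obtain ⟨h', hh', a', haa', rfl⟩ := Submodule.mem_sup.1 (htop hy)
    have h1 : σ h' a = 0 := ha' h' hh'
    rw [map_add, LinearMap.add_apply, h1, (hα i).apply_eq_zero haa' ha, add_zero]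
  have hcov := Subspace.biUnion_ne_univ_of_top_notMem
    (s := (Set.finite_range fun i => (η ⊔ α i).comap (σ.orthogonal η).subtype).toFinset)
    (by
      rw [Set.Finite.mem_toFinset]
      rintro ⟨i, hi⟩
      exact hN i hi)
  obtain ⟨⟨v, hv⟩, hv'⟩ := (Set.ne_univ_iff_exists_notMem _).1 hcov
  have hvi : ∀ i, v ∉ η ⊔ α i := fun i hi => hv' (Set.mem_biUnion
    ((Set.Finite.mem_toFinset _).2 ⟨i, rfl⟩) hi)
  have hvη : ∀ x ∈ η, σ x v = 0 := hv
  have hvη' : ∀ x ∈ η, σ v x = 0 := fun x hx => by rw [← hσ.neg_eq, hvη x hx, neg_zero]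
  refine hmax (η ⊔ Submodule.span ℝ {v}) ⟨?_, fun i => ?_⟩ ?_
  · intro x hx y hy
    obtain ⟨x₁, hx₁, x₂, hx₂, rfl⟩ := Submodule.mem_sup.1 hx
    obtain ⟨y₁, hy₁, y₂, hy₂, rfl⟩ := Submodule.mem_sup.1 hy
    obtain ⟨r, rfl⟩ := Submodule.mem_span_singleton.1 hx₂
    obtain ⟨s, rfl⟩ := Submodule.mem_span_singleton.1 hy₂
    have h1 : σ y₁ x₁ = 0 := hiso hx₁ y₁ hy₁
    simp [h1, hvη _ hy₁, hvη' _ hx₁, hσ.self_eq_zero]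
  · rw [Submodule.eq_bot_iff]
    rintro x ⟨hxα, hx⟩
    obtain ⟨y, hy, z, hz, rfl⟩ := Submodule.mem_sup.1 hx
    obtain ⟨r, rfl⟩ := Submodule.mem_span_singleton.1 hz
    by_cases hr : r = 0
    · subst hr
      have h0 : y ∈ α i ⊓ η := ⟨by simpa using hxα, hy⟩
      rw [htr i, Submodule.mem_bot] at h0
      simp [h0]
    · refine absurd (Submodule.mem_sup.2 ⟨-(r⁻¹ • y), η.neg_mem (η.smul_mem _ hy),
        r⁻¹ • (y + r • v), (α i).smul_mem _ hxα, ?_⟩) (hvi i)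
      rw [smul_add, smul_smul, inv_mul_cancel₀ hr, one_smul]
      abel
  · refine lt_of_le_of_ne le_sup_left fun heq => ?_
    obtain ⟨i⟩ := ‹Nonempty ι›
    refine hvi i (le_sup_left (a := η) ?_)
    rw [heq]
    exact le_sup_right (a := η) (Submodule.mem_span_singleton_self v)

omit hσ in
theorem IsLagrangian.finrank_add {μ : Submodule ℝ X} (h : IsLagrangian σ μ) :
    Module.finrank ℝ μ + Module.finrank ℝ μ = Module.finrank ℝ X := by
  have h1 := LinearMap.BilinForm.finrank_orthogonal hnd μ
  have h2 := Submodule.finrank_le μ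
  rw [show σ.orthogonal μ = μ from h] at h1
  omega

omit hσ in
theorem IsLagrangian.isCompl {μ ν : Submodule ℝ X} (hμ : IsLagrangian σ μ)
    (hν : IsLagrangian σ ν) (h : μ ⊓ ν = ⊥) : IsCompl μ ν := by
  refine ⟨disjoint_iff.2 h, codisjoint_iff.2 (Submodule.eq_top_of_finrank_eq ?_)⟩
  have h1 := Submodule.finrank_sup_add_finrank_inf_eq μ ν
  rw [h, finrank_bot] at h1
  have h2 := hμ.finrank_add hnd
  have h3 := hν.finrank_add hnd
  omega

theorem finrank_inf_sup {α β γ : Submodule ℝ X} (hα : IsLagrangian σ α)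
    (hβ : IsLagrangian σ β) (hγ : IsLagrangian σ γ) :
    Module.finrank ℝ ↥(β ⊓ (α ⊔ γ)) + Module.finrank ℝ ↥(α ⊓ γ) =
      Module.finrank ℝ β + Module.finrank ℝ ↥(α ⊓ β ⊓ γ) := by
  have hαγ : σ.orthogonal (α ⊓ γ) = α ⊔ γ := by
    have h := orthogonal_sup (σ := σ) α γ
    rw [show σ.orthogonal α = α from hα, show σ.orthogonal γ = γ from hγ] at h
    rw [← h, LinearMap.BilinForm.orthogonal_orthogonal hnd hσ.isRefl]
  have h1 := orthogonal_sup (σ := σ) β (α ⊓ γ)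
  rw [hαγ, show σ.orthogonal β = β from hβ] at h1
  have h2 := LinearMap.BilinForm.finrank_orthogonal hnd (β ⊔ α ⊓ γ)
  rw [h1] at h2
  have h3 := Submodule.finrank_sup_add_finrank_inf_eq β (α ⊓ γ)
  have h4 := hβ.finrank_add hnd
  have h5 := Submodule.finrank_le (β ⊔ α ⊓ γ)
  rw [show β ⊓ (α ⊓ γ) = α ⊓ β ⊓ γ by rw [inf_left_comm, inf_assoc]] at h3
  omega

omit hσ hnd in
/-- `C`, a complement of `α ∩ β ∩ γ` in `α ∩ γ`. -/
theorem exists_compl_inf (α β γ : Submodule ℝ X) :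
    ∃ C : Submodule ℝ X, C ≤ α ⊓ γ ∧ (∀ x ∈ C, x ∈ β → x = 0) ∧
      Module.finrank ℝ C + Module.finrank ℝ ↥(α ⊓ β ⊓ γ) = Module.finrank ℝ ↥(α ⊓ γ) := by
  have hle : α ⊓ β ⊓ γ ≤ α ⊓ γ := inf_le_inf_right _ inf_le_left
  obtain ⟨C', hC'⟩ := Submodule.exists_isCompl ((α ⊓ β ⊓ γ).comap (α ⊓ γ).subtype)
  refine ⟨C'.map (α ⊓ γ).subtype, Submodule.map_subtype_le _ _, ?_, ?_⟩
  · rintro _ ⟨x, hx, rfl⟩ hβ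
    have h1 := hC'.disjoint.le_bot (show x ∈ _ ⊓ C' from ⟨⟨⟨x.2.1, hβ⟩, x.2.2⟩, hx⟩)
    rw [Submodule.mem_bot] at h1
    simp [h1]
  · have h1 := Submodule.finrank_add_eq_of_isCompl hC'
    rw [(Submodule.comapSubtypeEquivOfLe hle).finrank_eq] at h1
    rw [Submodule.finrank_map_subtype_eq]
    omega

/-- If the Lagrangian `η` is transversal to `α` and `β`, then
`n₊ Q(α, β; η) + n₊ Q(β, γ; η) = n₊ Q(α, γ; η) + ι(α, β, γ)`.  With `π` the projection onto `β`
along `η`, both sides are the positive index of `-σ(a, π a') - σ(π c, c')` on `α × γ`: the left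
side by splitting this space along its two factors, the right side by `posIndex_eq_add` for the
subspaces `a + c ∈ η` and `a + c ∈ β`. -/
theorem posIndex_add_posIndex_tripleForm {α β γ η : Submodule ℝ X} (hα : IsLagrangian σ α)
    (hβ : IsLagrangian σ β) (hγ : IsLagrangian σ γ) (hη : IsLagrangian σ η)
    (hαη : α ⊓ η = ⊥) (hβη : β ⊓ η = ⊥) (C : Submodule ℝ X) (hC : C ≤ α ⊓ γ)
    (hCβ : ∀ x ∈ C, x ∈ β → x = 0) (hCfin : Module.finrank ℝ C +
      Module.finrank ℝ ↥(α ⊓ β ⊓ γ) = Module.finrank ℝ ↥(α ⊓ γ)) :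
    posIndex (tripleForm σ α β η) + posIndex (tripleForm σ β γ η) =
      posIndex (tripleForm σ α γ η) + posIndex (tripleForm σ α β γ) +
        (Module.finrank ℝ C : ℕ∞) := by
  have hcβ := hβ.isCompl hnd hη hβη
  obtain ⟨π, hπβ, hπη⟩ : ∃ π : X →ₗ[ℝ] X, (∀ x, π x ∈ β) ∧ ∀ x, x - π x ∈ η := by
    refine ⟨β.subtype ∘ₗ β.projectionOnto η hcβ, fun x => (β.projectionOnto η hcβ x).2,
      fun x => ?_⟩
    obtain ⟨y, hy, z, hz, rfl⟩ := Submodule.mem_sup.1 (hcβ.sup_eq_top ▸ Submodule.mem_top : x ∈ β ⊔ η)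
    have h1 : β.projectionOnto η hcβ y = ⟨y, hy⟩ :=
      Submodule.projectionOnto_apply_left hcβ ⟨y, hy⟩
    have h2 : β.projectionOnto η hcβ z = 0 :=
      (Submodule.projectionOnto_apply_eq_zero_iff hcβ).2 hz
    simp [h1, h2, hz]
  have hπ_eq : ∀ {x y : X}, y ∈ β → x - y ∈ η → π x = y := fun {x y} hy hxy => by
    have h1 : π x - y ∈ β ⊓ η := ⟨β.sub_mem (hπβ x) hy, by
      rw [show π x - y = (x - y) - (x - π x) by abel]
      exact η.sub_mem hxy (hπη x)⟩
    rw [hβη, Submodule.mem_bot, sub_eq_zero] at h1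
    exact h1
  have hswap : ∀ x y, σ y x = -σ x y := fun x y => (hσ.neg_eq x y).symm
  -- the boundary terms vanish because `η` and `β` are isotropic
  have cross : ∀ x y, σ x y = σ x (π y) + σ (π x) y := fun x y => by
    have h1 := hη.apply_eq_zero (hπη x) (hπη y)
    have h2 := hβ.apply_eq_zero (hπβ x) (hπβ y)
    simp only [map_sub, LinearMap.sub_apply, h2] at h1
    linarith
  let B : LinearMap.BilinForm ℝ (α × γ) :=
    -(σ.compl₁₂ (α.subtype ∘ₗ LinearMap.fst ℝ α γ) (π ∘ₗ α.subtype ∘ₗ LinearMap.fst ℝ α γ)) -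
      σ.compl₁₂ (π ∘ₗ γ.subtype ∘ₗ LinearMap.snd ℝ α γ) (γ.subtype ∘ₗ LinearMap.snd ℝ α γ)
  have hBa : ∀ z w : α × γ, B z w = -σ z.1 (π w.1) - σ (π z.2) w.2 := fun z w => rfl
  have hB : ∀ z w, B z w = B w z := fun z w => by
    have h1 := cross z.1 w.1
    have h2 := cross w.2 z.2
    rw [hα.apply_eq_zero z.1.2 w.1.2] at h1
    rw [hγ.apply_eq_zero w.2.2 z.2.2] at h2
    rw [hBa, hBa, hswap w.2 (π z.2), hswap (π z.1) w.1]
    linarith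
  -- splitting along the factors
  have hsplit := posIndex_eq_add hB (LinearMap.fst ℝ α γ) (LinearMap.ker (LinearMap.snd ℝ α γ)) ⊥
    (fun y hy e he => by
      have h1 : y.1 = 0 := hy
      have h2 : e.2 = 0 := he
      simp [hBa, h1, h2]) bot_le (fun c hc => by simp [(Submodule.mem_bot ℝ).1 hc])
    (fun c hc _ => (Submodule.mem_bot ℝ).1 hc) (by
      rw [finrank_bot, add_zero]
      refine Submodule.finrank_mono ?_
      rintro _ ⟨x, rfl⟩
      exact ⟨(x.1, 0), rfl, rfl⟩)
  have e1 : posIndex (tripleForm σ α β η) =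
      posIndex (fun z : LinearMap.ker (LinearMap.snd ℝ α γ) => B z z) := by
    refine posIndex_tripleForm_eq hβ hη
      (α.subtype ∘ₗ LinearMap.fst ℝ α γ ∘ₗ (LinearMap.ker (LinearMap.snd ℝ α γ)).subtype)
      (fun z => -π z.1.1) _ (fun z => z.1.1.2) (fun x hx => ⟨⟨(⟨x, hx.1⟩, 0), rfl⟩, rfl⟩)
      (fun z => β.neg_mem (hπβ _)) (fun z => ?_) (fun z => ?_)
    · rw [← sub_eq_add_neg]; exact hπη _
    · have h2 : z.1.2 = 0 := z.2
      simp [hBa, h2]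
  have e2 : posIndex (tripleForm σ β γ η) =
      posIndex (fun z : LinearMap.ker (LinearMap.fst ℝ α γ) => B z z) := by
    refine posIndex_tripleForm_eq hγ hη
      (-(π ∘ₗ γ.subtype ∘ₗ LinearMap.snd ℝ α γ ∘ₗ (LinearMap.ker (LinearMap.fst ℝ α γ)).subtype))
      (fun z => z.1.2) _ (fun z => β.neg_mem (hπβ _)) (fun x hx => ?_)
      (fun z => z.1.2.2) (fun z => ?_) (fun z => ?_)
    · obtain ⟨c, hc, d, hd, rfl⟩ := Submodule.mem_sup.1 hx.2
      refine ⟨⟨(0, ⟨-c, γ.neg_mem hc⟩), rfl⟩, ?_⟩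
      have : π (-c) = -(c + d) := hπ_eq (β.neg_mem hx.1) (by simpa using hd)
      simpa using congrArg Neg.neg this
    · have := hπη (z.1.2 : X)
      simpa [sub_eq_neg_add] using this
    · have h2 : z.1.1 = 0 := z.2
      simp [hBa, h2]
  -- the subspaces `a + c ∈ η` and `a + c ∈ β`
  let s : α × γ →ₗ[ℝ] X := α.subtype.coprod γ.subtype
  have hs : ∀ z, s z = z.1 + z.2 := fun z => rfl
  let f : α × γ →ₗ[ℝ] X := π ∘ₗ s
  have hf : ∀ z, f z = π z.1 + π z.2 := fun z => map_add π _ _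
  let E : Submodule ℝ (α × γ) := β.comap s
  let j : C →ₗ[ℝ] α × γ := (Submodule.inclusion (hC.trans inf_le_left)).prod
    (-Submodule.inclusion (hC.trans inf_le_right))
  have hj : Function.Injective j := fun x y h =>
    Subtype.ext (congrArg (fun z : α × γ => (z.1 : X)) h)
  have hj1 : ∀ c, ((j c).1 : X) = c := fun c => rfl
  have hj2 : ∀ c, ((j c).2 : X) = -c := fun c => rfl
  have hEmap : E.map f = β ⊓ (α ⊔ γ) := by
    refine le_antisymm ?_ ?_
    · rintro _ ⟨z, hz, rfl⟩
      refine ⟨hπβ _, ?_⟩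
      have : f z = s z := hπ_eq hz (by simp)
      rw [this, hs]
      exact Submodule.add_mem_sup z.1.2 z.2.2
    · rintro x ⟨hx, hx'⟩
      obtain ⟨a, ha, c, hc, rfl⟩ := Submodule.mem_sup.1 hx'
      exact ⟨(⟨a, ha⟩, ⟨c, hc⟩), hx, hπ_eq hx (by simp [hs])⟩
  have hfr : LinearMap.range f ≤ β := by
    rintro _ ⟨z, rfl⟩
    exact hπβ _
  have hmain := posIndex_eq_add hB f E (LinearMap.range j)
    (fun y hy e he => by
      have h1 : π y.2 = -π y.1 := by
        rw [hf] at hy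
        exact (neg_eq_of_add_eq_zero_right hy).symm
      have h2 : σ (π y.1) (e.1 + e.2) = 0 := hβ.apply_eq_zero (hπβ _) he
      have h3 := cross y.1 e.1
      rw [hα.apply_eq_zero y.1.2 e.1.2] at h3
      rw [map_add] at h2
      rw [hBa, h1, map_neg, LinearMap.neg_apply]
      linarith)
    (by
      rintro _ ⟨c, rfl⟩
      change s (j c) ∈ β
      rw [hs, hj1, hj2, add_neg_cancel]
      exact β.zero_mem)
    (by
      rintro _ ⟨c, rfl⟩
      rw [hf, hj1, hj2, map_neg, add_neg_cancel])
    (by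
      rintro _ ⟨c, rfl⟩ h
      have hcα' : (c : X) ∈ α := (hC c.2).1
      have hcγ' : (c : X) ∈ γ := (hC c.2).2
      have h1 : π c ∈ α := hα.mem fun m hm => by
        have h2 := h (⟨m, hm⟩, 0)
        rw [hB, hBa] at h2
        simpa [hj1] using h2
      have h4 : (c : X) - π c ∈ α ⊓ η := ⟨α.sub_mem hcα' h1, hπη _⟩
      rw [hαη, Submodule.mem_bot, sub_eq_zero] at h4
      have h5 : c = 0 := Subtype.ext (hCβ c c.2 (h4 ▸ hπβ _))
      rw [h5, map_zero])
    (by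
      rw [hEmap, LinearMap.finrank_range_of_inj hj]
      have h1 := Submodule.finrank_mono hfr
      have h2 := finrank_inf_sup hσ hnd hα hβ hγ
      omega)
  have e3 : posIndex (tripleForm σ α γ η) = posIndex (fun z : LinearMap.ker f => B z z) := by
    refine posIndex_tripleForm_eq hγ hη
      (α.subtype ∘ₗ LinearMap.fst ℝ α γ ∘ₗ (LinearMap.ker f).subtype)
      (fun z => z.1.2) _ (fun z => z.1.1.2) (fun x hx => ?_)
      (fun z => z.1.2.2) (fun z => ?_) (fun z => ?_)
    · obtain ⟨c, hc, d, hd, h⟩ := Submodule.mem_sup.1 hx.2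
      refine ⟨⟨(⟨x, hx.1⟩, ⟨-c, γ.neg_mem hc⟩), ?_⟩, rfl⟩
      refine hπ_eq β.zero_mem ?_
      have : x - c = d := by rw [← h, add_sub_cancel_left]
      rw [hs, sub_zero]
      change x + -c ∈ η
      rwa [← sub_eq_add_neg, this]
    · have h1 := hπη (s z.1)
      have h2 : π (s z.1) = 0 := z.2
      rw [h2, sub_zero] at h1
      exact h1
    · have h1 : π z.1.1 + π z.1.2 = 0 := (hf _).symm.trans z.2
      have h2 := cross z.1.1 z.1.2
      change B z z = σ z.1.1 z.1.2
      rw [hBa, h2, eq_neg_of_add_eq_zero_left h1]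
      simp only [map_neg, LinearMap.neg_apply]
      ring
  have e4 : posIndex (tripleForm σ α β γ) = posIndex (fun z : E => B z z) := by
    refine posIndex_tripleForm_eq hβ hγ
      (α.subtype ∘ₗ LinearMap.fst ℝ α γ ∘ₗ E.subtype)
      (fun z => -s z) _ (fun z => z.1.1.2) (fun x hx => ?_)
      (fun z => β.neg_mem z.2) (fun z => ?_) (fun z => ?_)
    · obtain ⟨b, hb, c, hc, h⟩ := Submodule.mem_sup.1 hx.2
      refine ⟨⟨(⟨x, hx.1⟩, ⟨-c, γ.neg_mem hc⟩), ?_⟩, rfl⟩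
      change s _ ∈ β
      have : x - c = b := by rw [← h, add_sub_cancel_right]
      rw [hs]
      change x + -c ∈ β
      rwa [← sub_eq_add_neg, this]
    · have := γ.neg_mem z.1.2.2
      convert this using 1
      rw [hs]
      change (z.1.1 : X) + -(z.1.1 + z.1.2) = _
      abel
    · have h1 : π z.1.1 + π z.1.2 = z.1.1 + z.1.2 :=
        (hf _).symm.trans (hπ_eq (x := s z.1) z.2 (by rw [← hs, sub_self]; exact η.zero_mem))
      have h2 := cross z.1.1 z.1.2
      have h3 : π (z.1.1 : X) = z.1.1 + z.1.2 - π z.1.2 := eq_sub_of_add_eq h1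
      have h4 := hα.apply_eq_zero z.1.1.2 z.1.1.2
      have h5 := hγ.apply_eq_zero z.1.2.2 z.1.2.2
      change B z z = σ z.1.1 (-(z.1.1 + z.1.2))
      rw [hBa]
      rw [h3] at h2 ⊢
      simp only [map_add, map_sub, map_neg, LinearMap.add_apply, LinearMap.sub_apply] at h2 ⊢
      linarith
  rw [LinearMap.finrank_range_of_inj hj] at hmain
  rw [e1, e2, e3, e4, ← hmain, hsplit, finrank_bot, Nat.cast_zero, add_zero, add_comm]

/-- The cocycle identity of the triple index. -/
theorem tripleIndex_cocycle {α β γ δ : Submodule ℝ X} (hα : IsLagrangian σ α)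
    (hβ : IsLagrangian σ β) (hγ : IsLagrangian σ γ) (hδ : IsLagrangian σ δ) :
    tripleIndex σ α β δ + tripleIndex σ β γ δ = tripleIndex σ α γ δ + tripleIndex σ α β γ := by
  obtain ⟨η, hη, htr⟩ := exists_isLagrangian_inf_eq_bot hσ hnd ![α, β, γ] (by
    intro i
    fin_cases i <;> assumption)
  have hαη : α ⊓ η = ⊥ := htr 0
  have hβη : β ⊓ η = ⊥ := htr 1
  have hγη : γ ⊓ η = ⊥ := htr 2
  have key : ∀ {a b c : Submodule ℝ X}, IsLagrangian σ a → IsLagrangian σ b →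
      IsLagrangian σ c → a ⊓ η = ⊥ → b ⊓ η = ⊥ → tripleIndex σ a b c =
        ((posIndex (tripleForm σ a b η)).toNat : ℤ) + (posIndex (tripleForm σ b c η)).toNat -
          (posIndex (tripleForm σ a c η)).toNat := by
    intro a b c ha hb hc ha' hb'
    obtain ⟨C, h1, h2, h3⟩ := exists_compl_inf a b c
    have h := posIndex_add_posIndex_tripleForm hσ hnd ha hb hc hη ha' hb' C h1 h2 h3
    have n1 := posIndex_ne_top _ (tripleForm_zero (α := a) hb hη)
    have n2 := posIndex_ne_top _ (tripleForm_zero (α := b) hc hη)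
    have n3 := posIndex_ne_top _ (tripleForm_zero (α := a) hc hη)
    have n4 := posIndex_ne_top _ (tripleForm_zero (α := a) hb hc)
    unfold tripleIndex
    lift posIndex (tripleForm σ a b η) to ℕ using n1 with k1
    lift posIndex (tripleForm σ b c η) to ℕ using n2 with k2
    lift posIndex (tripleForm σ a c η) to ℕ using n3 with k3
    lift posIndex (tripleForm σ a b c) to ℕ using n4 with k4
    have h' : k1 + k2 = k3 + k4 + Module.finrank ℝ C := by exact_mod_cast h
    simp only [ENat.toNat_natCast]
    omega
  rw [key hα hβ hδ hαη hβη, key hβ hγ hδ hβη hγη, key hα hγ hδ hαη hγη, key hα hβ hγ hαη hβη]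
  ring

end Symplectic

/-! ### Closed symmetric operators with surjective adjoint -/

section Adjoint

variable {H : Type*} [NormedAddCommGroup H] [InnerProductSpace ℝ H] [CompleteSpace H]
  {A : H →ₗ.[ℝ] H}

/-- A closed densely defined operator is the adjoint of its adjoint. -/
theorem exists_apply_eq_of_inner_adjoint (hd : Dense (A.domain : Set H)) (hcl : A.IsClosed)
    {x y : H} (h : ∀ w : A.adjoint.domain, inner ℝ (A.adjoint w) x = inner ℝ (w : H) y) :
    ∃ a : A.domain, (a : H) = x ∧ A a = y := by
  let e := (WithLp.linearEquiv 2 ℝ (H × H)).symm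
  let G : Submodule ℝ (WithLp 2 (H × H)) := A.graph.map (e : H × H →ₗ[ℝ] WithLp 2 (H × H))
  have hG : IsClosed (G : Set (WithLp 2 (H × H))) := by
    have : (G : Set (WithLp 2 (H × H))) = WithLp.ofLp ⁻¹' (A.graph : Set (H × H)) := by
      ext z
      constructor
      · rintro ⟨p, hp, rfl⟩
        exact hp
      · intro hz
        exact ⟨WithLp.ofLp z, hz, rfl⟩
    rw [this]
    exact IsClosed.preimage (WithLp.prod_continuous_ofLp _ _ _) hcl
  have hmem : WithLp.toLp 2 (x, y) ∈ G := by
    rw [← hG.submodule_topologicalClosure_eq, ← Submodule.orthogonal_orthogonal_eq_closure]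
    intro z hz
    have hz' : ∀ a : A.domain, inner ℝ (-z.fst) (a : H) = inner ℝ z.snd (A a) := fun a => by
      have := hz (WithLp.toLp 2 ((a : H), A a)) ⟨_, A.mem_graph a, rfl⟩
      rw [WithLp.prod_inner_apply] at this
      change inner ℝ (a : H) z.fst + inner ℝ (A a) z.snd = 0 at this
      rw [inner_neg_left, real_inner_comm, real_inner_comm (A a) z.snd]
      linarith
    have hdom : z.snd ∈ A.adjoint.domain :=
      LinearPMap.mem_adjoint_domain_of_exists _ ⟨-z.fst, hz'⟩
    have happ : A.adjoint ⟨z.snd, hdom⟩ = -z.fst := LinearPMap.adjoint_apply_eq hd _ hz'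
    have h1 := h ⟨z.snd, hdom⟩
    rw [happ, inner_neg_left] at h1
    rw [WithLp.prod_inner_apply]
    change inner ℝ z.fst x + inner ℝ z.snd y = 0
    change _ = inner ℝ z.snd y at h1
    linarith
  obtain ⟨p, hp, hpe⟩ := hmem
  have hp' : p = (x, y) := congrArg WithLp.ofLp hpe
  rw [hp'] at hp
  obtain ⟨a, ha, hb⟩ := (A.mem_graph_iff).1 hp
  exact ⟨a, ha, hb⟩

theorem adjoint_apply_of_le (hsym : A ≤ A.adjoint) {a : A.domain} {x : A.adjoint.domain}
    (h : (a : H) = x) : A.adjoint x = A a :=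
  (hsym.2 h).symm

theorem boundaryForm_of_mem_minDomain (hd : Dense (A.domain : Set H)) (hsym : A ≤ A.adjoint)
    {x : A.adjoint.domain} (hx : x ∈ minDomain A) (w : A.adjoint.domain) :
    boundaryForm A x w = 0 := by
  rw [boundaryForm_apply, adjoint_apply_of_le hsym (a := ⟨x, hx⟩) rfl, real_inner_comm,
    LinearPMap.adjoint_isFormalAdjoint hd w ⟨x, hx⟩, real_inner_comm, sub_self]

theorem boundaryForm_swap (x y : A.adjoint.domain) : boundaryForm A y x = -boundaryForm A x y := by
  rw [boundaryForm_apply, boundaryForm_apply, real_inner_comm, real_inner_comm (A.adjoint y)]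
  ring

theorem mem_minDomain_of_boundaryForm (hd : Dense (A.domain : Set H)) (hcl : A.IsClosed)
    {x : A.adjoint.domain} (hx : ∀ w, boundaryForm A w x = 0) : x ∈ minDomain A := by
  obtain ⟨a, ha, -⟩ := exists_apply_eq_of_inner_adjoint hd hcl (x := (x : H)) (y := A.adjoint x)
    fun w => by
      have := hx w
      rw [boundaryForm_apply] at this
      linarith
  change (x : H) ∈ A.domain
  rw [← ha]
  exact a.2

variable {U : Submodule ℝ A.adjoint.domain}

theorem kerAdjoint_apply {k : A.adjoint.domain} (hk : k ∈ kerAdjoint A) : A.adjoint k = 0 := hk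

theorem adjoint_surjective (hd : Dense (A.domain : Set H)) (hcl : A.IsClosed)
    (hsym : A ≤ A.adjoint) (hF : IsFredholm A.adjoint)
    (hdisj : Disjoint (minDomain A) (kerAdjoint A)) (h : H) :
    ∃ w : A.adjoint.domain, A.adjoint w = h := by
  have hbot : (LinearMap.range A.adjoint.toFun)ᗮ = ⊥ := by
    rw [Submodule.eq_bot_iff]
    intro y hy
    obtain ⟨a, ha, ha0⟩ := exists_apply_eq_of_inner_adjoint hd hcl (x := y) (y := 0) fun w => by
      rw [inner_zero_right]
      exact hy _ ⟨w, rfl⟩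
    let x : A.adjoint.domain := ⟨a, hsym.1 a.2⟩
    have hx : x ∈ minDomain A := a.2
    have hk : x ∈ kerAdjoint A := (adjoint_apply_of_le hsym (a := a) rfl).trans ha0
    have := Submodule.disjoint_def.1 hdisj x hx hk
    rw [← ha]
    exact congrArg Subtype.val this
  have htop : LinearMap.range A.adjoint.toFun = ⊤ := by
    rw [← hF.2.1.submodule_topologicalClosure_eq, ← Submodule.orthogonal_orthogonal_eq_closure,
      hbot, Submodule.bot_orthogonal_eq_top]
  exact LinearMap.range_eq_top.1 htop h

/-- Closed range: if `A*` is onto, then `A` maps onto the orthogonal complement of `ker A*`.  For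
`y` in this complement, `A* w ↦ ⟨w, y⟩` is well defined and, by the open mapping theorem for the
graph of `A*`, bounded; the vector representing it is a preimage of `y`. -/
theorem exists_apply_eq_of_orthogonal_ker (hd : Dense (A.domain : Set H)) (hcl : A.IsClosed)
    (hsurj : ∀ h, ∃ w : A.adjoint.domain, A.adjoint w = h) {y : H}
    (hy : ∀ k ∈ kerAdjoint A, inner ℝ (k : H) y = 0) : ∃ a : A.domain, A a = y := by
  have : CompleteSpace A.adjoint.graph := (LinearPMap.adjoint_isClosed hd).completeSpace_coe
  let f : A.adjoint.graph →L[ℝ] H :=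
    (ContinuousLinearMap.snd ℝ H H).comp A.adjoint.graph.subtypeL
  obtain ⟨C, hC0, hC⟩ := ContinuousLinearMap.exists_preimage_norm_le f fun h => by
    obtain ⟨w, hw⟩ := hsurj h
    exact ⟨⟨_, A.adjoint.mem_graph w⟩, hw⟩
  have hC' : ∀ h, ∃ w : A.adjoint.domain, A.adjoint w = h ∧ ‖(w : H)‖ ≤ C * ‖h‖ := fun h => by
    obtain ⟨p, hp, hn⟩ := hC h
    obtain ⟨w, hw1, hw2⟩ := A.adjoint.mem_graph_iff.1 p.2
    refine ⟨w, hw2.trans hp, ?_⟩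
    rw [hw1]
    exact (norm_fst_le (p : H × H)).trans hn
  choose s hs hsn using hC'
  have hwd : ∀ w w' : A.adjoint.domain, A.adjoint w = A.adjoint w' →
      inner ℝ (w : H) y = inner ℝ (w' : H) y := fun w w' h => by
    have hk : w - w' ∈ kerAdjoint A := by
      change A.adjoint.toFun (w - w') = 0
      rw [map_sub]
      exact sub_eq_zero.2 h
    have := hy _ hk
    rw [Submodule.coe_sub, inner_sub_left] at this
    linarith
  let φ₀ : H →ₗ[ℝ] ℝ :=
    { toFun := fun h => inner ℝ (s h : H) y
      map_add' := fun h h' => by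
        rw [← inner_add_left, ← Submodule.coe_add]
        exact hwd _ _ (by rw [LinearPMap.map_add, hs, hs, hs])
      map_smul' := fun r h => by
        rw [RingHom.id_apply, smul_eq_mul, ← real_inner_smul_left, ← Submodule.coe_smul]
        exact hwd _ _ (by rw [LinearPMap.map_smul, hs, hs]) }
  let φ : H →L[ℝ] ℝ := φ₀.mkContinuous (C * ‖y‖) fun h => by
    refine (norm_inner_le_norm _ _).trans ?_
    calc ‖(s h : H)‖ * ‖y‖ ≤ C * ‖h‖ * ‖y‖ := by gcongr; exact hsn h
      _ = C * ‖y‖ * ‖h‖ := by ring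
  obtain ⟨a, -, ha⟩ := exists_apply_eq_of_inner_adjoint hd hcl
    (x := (InnerProductSpace.toDual ℝ H).symm φ) (y := y) fun w => by
      rw [real_inner_comm, InnerProductSpace.toDual_symm_apply]
      exact hwd _ _ (hs _)
  exact ⟨a, ha⟩

/-- The setting of the abstract theorem: `A` is closed, densely defined and symmetric, `A*` is
Fredholm, and `dom A* = dom A ⊕ U` with `ker A* ⊆ U`. -/
structure IsBoundarySetting (A : H →ₗ.[ℝ] H) (U : Submodule ℝ A.adjoint.domain) : Prop where
  dense : Dense (A.domain : Set H)
  closed : A.IsClosed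
  symm : A ≤ A.adjoint
  fredholm : IsFredholm A.adjoint
  compl : IsCompl (minDomain A) U
  ker_le : kerAdjoint A ≤ U

namespace IsBoundarySetting

variable (h : IsBoundarySetting A U)
include h

theorem surjective (y : H) : ∃ w : A.adjoint.domain, A.adjoint w = y :=
  adjoint_surjective h.dense h.closed h.symm h.fredholm (h.compl.disjoint.mono_right h.ker_le) y

theorem exists_add (x : A.adjoint.domain) : ∃ a ∈ minDomain A, ∃ u ∈ U, a + u = x :=
  Submodule.mem_sup.1 (h.compl.sup_eq_top ▸ Submodule.mem_top : x ∈ minDomain A ⊔ U)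

theorem inner_adjoint (w : A.adjoint.domain) {x : A.adjoint.domain} (hx : x ∈ minDomain A) :
    inner ℝ (A.adjoint w) (x : H) = inner ℝ (w : H) (A.adjoint x) := by
  have := boundaryForm_of_mem_minDomain h.dense h.symm hx w
  rw [boundaryForm_apply, real_inner_comm, real_inner_comm (w : H)] at this
  linarith

theorem mem_ker_of_orthogonal {u : A.adjoint.domain} (hu : u ∈ U)
    (hk : ∀ k ∈ kerAdjoint A, inner ℝ (k : H) (A.adjoint u) = 0) : u ∈ kerAdjoint A := by
  obtain ⟨a, ha⟩ := exists_apply_eq_of_orthogonal_ker h.dense h.closed h.surjective hk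
  let x : A.adjoint.domain := ⟨a, h.symm.1 a.2⟩
  have hx : x ∈ minDomain A := a.2
  have hxu : u - x ∈ kerAdjoint A := by
    change A.adjoint.toFun (u - x) = 0
    rw [map_sub]
    exact sub_eq_zero.2 (ha.symm.trans (adjoint_apply_of_le h.symm (a := a) rfl).symm)
  have hxU : x ∈ U := by
    have := U.sub_mem hu (h.ker_le hxu)
    simpa using this
  have hx0 := Submodule.disjoint_def.1 h.compl.disjoint x hx hxU
  rwa [hx0, sub_zero] at hxu

/-- `U` is finite-dimensional: the pairing `u ↦ ⟨A* u, ·⟩` of `U` with `ker A*` has kernel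
`ker A*`. -/
theorem finiteDimensional : FiniteDimensional ℝ U := by
  have hfd : FiniteDimensional ℝ (kerAdjoint A) := h.fredholm.1
  let Φ : U →ₗ[ℝ] Module.Dual ℝ (kerAdjoint A) := (innerₗ H).compl₁₂
    (A.adjoint.toFun ∘ₗ U.subtype) (A.adjoint.domain.subtype ∘ₗ (kerAdjoint A).subtype)
  have hker : (LinearMap.ker Φ).map U.subtype ≤ kerAdjoint A := by
    rintro _ ⟨u, hu, rfl⟩
    refine h.mem_ker_of_orthogonal u.2 fun k hk => ?_
    rw [real_inner_comm]
    exact LinearMap.congr_fun hu ⟨k, hk⟩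
  have h1 : FiniteDimensional ℝ ↥((LinearMap.ker Φ).map U.subtype) :=
    Submodule.finiteDimensional_of_le hker
  have h2 : FiniteDimensional ℝ (LinearMap.ker Φ) :=
    LinearEquiv.finiteDimensional
      (Submodule.equivMapOfInjective U.subtype U.injective_subtype (LinearMap.ker Φ)).symm
  have h3 : FiniteDimensional ℝ (U ⧸ LinearMap.ker Φ) :=
    Module.Finite.equiv Φ.quotKerEquivRange.symm
  exact Module.Finite.of_submodule_quotient (LinearMap.ker Φ)

omit h in
theorem rho_apply (x y : U) : rho A U x y = boundaryForm A x y := rfl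

omit h in
theorem rho_isAlt : (rho A U).IsAlt := fun x => by
  have := boundaryForm_swap (A := A) (x : A.adjoint.domain) x
  rw [← rho_apply] at this
  linarith

theorem rho_nondegenerate : (rho A U).Nondegenerate := by
  have key : ∀ x : U, (∀ y : U, rho A U y x = 0) → x = 0 := fun x hx => by
    refine Subtype.ext (Submodule.disjoint_def.1 h.compl.disjoint x ?_ x.2)
    refine mem_minDomain_of_boundaryForm h.dense h.closed fun w => ?_
    obtain ⟨a, ha, u, hu, rfl⟩ := h.exists_add w
    rw [map_add, LinearMap.add_apply, boundaryForm_of_mem_minDomain h.dense h.symm ha, zero_add]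
    exact hx ⟨u, hu⟩
  refine ⟨fun x hx => key x fun y => ?_, fun x hx => key x hx⟩
  rw [← rho_isAlt.neg_eq, hx y, neg_zero]

theorem cauchySubspace_eq : cauchySubspace A U h.compl = (kerAdjoint A).comap U.subtype := by
  ext x
  constructor
  · rintro ⟨k, hk, rfl⟩
    have : U.projectionOnto (minDomain A) h.compl.symm k = ⟨k, h.ker_le hk⟩ :=
      Submodule.projectionOnto_apply_left h.compl.symm ⟨k, h.ker_le hk⟩
    rw [this]
    exact hk
  · intro hx
    exact ⟨x, hx, Submodule.projectionOnto_apply_left h.compl.symm x⟩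

theorem isLagrangian_cauchySubspace : IsLagrangian (rho A U) (cauchySubspace A U h.compl) := by
  rw [h.cauchySubspace_eq]
  refine le_antisymm (fun u hu => ?_) fun u hu k hk => ?_
  · refine h.mem_ker_of_orthogonal u.2 fun k hk => ?_
    have h1 : rho A U ⟨k, h.ker_le hk⟩ u = 0 := hu ⟨k, h.ker_le hk⟩ hk
    rw [rho_apply, boundaryForm_apply] at h1
    simp only [kerAdjoint_apply hk, inner_zero_left, sub_zero] at h1
    exact h1
  · rw [rho_apply, boundaryForm_apply, kerAdjoint_apply (k := (k : A.adjoint.domain)) hk,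
      kerAdjoint_apply (k := (u : A.adjoint.domain)) hu, inner_zero_left, inner_zero_right,
      sub_zero]

end IsBoundarySetting

end Adjoint

/-! ### The Friedrichs extension -/

section Friedrichs

variable {H : Type*} [NormedAddCommGroup H] [InnerProductSpace ℝ H]

/-- The shifted form `⟨A a, b⟩ - c ⟨a, b⟩` on `dom A`. -/
noncomputable def shiftedForm (A : H →ₗ.[ℝ] H) (c : ℝ) : LinearMap.BilinForm ℝ A.domain :=
  (innerₗ H).compl₁₂ A.toFun A.domain.subtype -
    c • (innerₗ H).compl₁₂ A.domain.subtype A.domain.subtype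

theorem shiftedForm_apply (A : H →ₗ.[ℝ] H) (c : ℝ) (a b : A.domain) :
    shiftedForm A c a b = inner ℝ (A a) (b : H) - c * inner ℝ (a : H) b := rfl

theorem shiftedForm_self (A : H →ₗ.[ℝ] H) (c : ℝ) (a : A.domain) :
    shiftedForm A c a a = opForm A a - c * ‖(a : H)‖ ^ 2 := by
  rw [shiftedForm_apply, real_inner_self_eq_norm_sq]
  rfl

variable [CompleteSpace H] {A : H →ₗ.[ℝ] H}

theorem inner_apply_comm (hd : Dense (A.domain : Set H)) (hsym : A ≤ A.adjoint) (a b : A.domain) :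
    inner ℝ (A a) (b : H) = inner ℝ (a : H) (A b) := by
  rw [hsym.2 (x := a) (y := ⟨a, hsym.1 a.2⟩) rfl]
  exact LinearPMap.adjoint_isFormalAdjoint hd ⟨a, hsym.1 a.2⟩ b

theorem shiftedForm_comm (hd : Dense (A.domain : Set H)) (hsym : A ≤ A.adjoint) (c : ℝ)
    (a b : A.domain) : shiftedForm A c a b = shiftedForm A c b a := by
  rw [shiftedForm_apply, shiftedForm_apply, inner_apply_comm hd hsym, real_inner_comm (A b),
    real_inner_comm (b : H)]

/-- Let `u n → x` and `v n → y` be Cauchy for the form of `A`, and `y ∈ dom A*`.  The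
Cauchy-Schwarz inequality for the shifted form compares `⟨A (u n), v n⟩` with
`lim_m ⟨A (u n), v m⟩ = ⟨u n, A* y⟩`. -/
theorem tendsto_inner_of_form_cauchy (hd : Dense (A.domain : Set H)) (hsym : A ≤ A.adjoint)
    (hB : IsLowerBounded A) {u v : ℕ → A.domain} {x : H} {y : A.adjoint.domain}
    (hu : Tendsto (fun n => (u n : H)) atTop (𝓝 x))
    (hv : Tendsto (fun n => (v n : H)) atTop (𝓝 (y : H)))
    (hqu : Tendsto (fun p : ℕ × ℕ => opForm A (u p.1 - u p.2)) atTop (𝓝 0))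
    (hqv : Tendsto (fun p : ℕ × ℕ => opForm A (v p.1 - v p.2)) atTop (𝓝 0)) :
    Tendsto (fun n => inner ℝ (A (u n)) (v n : H)) atTop (𝓝 (inner ℝ x (A.adjoint y))) := by
  obtain ⟨c, hc⟩ := hB
  have hpos : ∀ a, 0 ≤ shiftedForm A c a a := fun a => by
    rw [shiftedForm_self]
    linarith [hc a]
  have hcs : ∀ a b, shiftedForm A c a b ^ 2 ≤ shiftedForm A c a a * shiftedForm A c b b :=
    fun a b => (shiftedForm A c).apply_sq_le_of_symm hpos
      ⟨fun a b => shiftedForm_comm hd hsym c a b⟩ a b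
  have hlim : ∀ {w : ℕ → A.domain} {z : H}, Tendsto (fun n => (w n : H)) atTop (𝓝 z) →
      Tendsto (fun p : ℕ × ℕ => opForm A (w p.1 - w p.2)) atTop (𝓝 0) →
      Tendsto (fun p : ℕ × ℕ => shiftedForm A c (w p.1 - w p.2) (w p.1 - w p.2)) atTop (𝓝 0) := by
    intro w z hw hq
    simp_rw [shiftedForm_self]
    simpa using hq.sub (((tendsto_sub_atTop hw).norm.pow 2).const_mul c)
  have hev : ∀ {w : ℕ → A.domain} {z : H}, Tendsto (fun n => (w n : H)) atTop (𝓝 z) →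
      Tendsto (fun p : ℕ × ℕ => opForm A (w p.1 - w p.2)) atTop (𝓝 0) → ∀ ε > 0, ∃ N, ∀ n ≥ N,
      ∀ m ≥ N, shiftedForm A c (w n - w m) (w n - w m) < ε := by
    intro w z hw hq ε hε
    obtain ⟨⟨N₁, N₂⟩, hN⟩ := eventually_atTop.1 ((hlim hw hq).eventually (gt_mem_nhds hε))
    exact ⟨max N₁ N₂, fun n hn m hm => hN (n, m)
      ⟨(le_max_left _ _).trans hn, (le_max_right _ _).trans hm⟩⟩
  obtain ⟨M, N₀, hM0, hM⟩ : ∃ M N₀, 0 < M ∧ ∀ n ≥ N₀, shiftedForm A c (u n) (u n) ≤ M := by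
    obtain ⟨N₀, hN₀⟩ := hev hu hqu 1 one_pos
    refine ⟨2 + 2 * shiftedForm A c (u N₀) (u N₀), N₀, by linarith [hpos (u N₀)], fun n hn => ?_⟩
    have h1 := hN₀ n hn N₀ le_rfl
    have h2 := hpos (u n - u N₀ - u N₀)
    simp only [map_sub, LinearMap.sub_apply] at h1 h2
    linarith
  have hD : Tendsto (fun n => inner ℝ (A (u n)) (v n : H) - c * inner ℝ (u n : H) (v n : H) -
      (inner ℝ (u n : H) (A.adjoint y) - c * inner ℝ (u n : H) (y : H))) atTop (𝓝 0) := by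
    rw [Metric.tendsto_atTop]
    intro ε hε
    obtain ⟨N, hN⟩ := hev hv hqv (ε ^ 2 / (2 * M)) (by positivity)
    refine ⟨max N N₀, fun n hn => ?_⟩
    have hn1 := (le_max_left _ _).trans hn
    have hn2 := (le_max_right _ _).trans hn
    have hm : ∀ m ≥ N, shiftedForm A c (u n) (v n - v m) ^ 2 ≤ ε ^ 2 / 2 := fun m hm =>
      calc _ ≤ _ := hcs _ _
        _ ≤ M * (ε ^ 2 / (2 * M)) :=
          mul_le_mul (hM n hn2) (hN n hn1 m hm).le (hpos _) hM0.le
        _ = ε ^ 2 / 2 := by field_simp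
    have hl : Tendsto (fun m => shiftedForm A c (u n) (v n - v m) ^ 2) atTop
        (𝓝 ((inner ℝ (A (u n)) (v n : H) - c * inner ℝ (u n : H) (v n : H) -
          (inner ℝ (u n : H) (A.adjoint y) - c * inner ℝ (u n : H) (y : H))) ^ 2)) := by
      have e : inner ℝ (u n : H) (A.adjoint y) = inner ℝ (A (u n)) (y : H) := by
        rw [real_inner_comm, LinearPMap.adjoint_isFormalAdjoint hd y (u n), real_inner_comm]
      rw [e]
      simp_rw [map_sub, shiftedForm_apply]
      exact (tendsto_const_nhds.sub ((tendsto_const_nhds.inner hv).sub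
        ((tendsto_const_nhds.inner hv).const_mul c))).pow 2
    have h3 := le_of_tendsto hl (eventually_atTop.2 ⟨N, hm⟩)
    rw [Real.dist_eq, sub_zero]
    refine abs_lt_of_sq_lt_sq (h3.trans_lt ?_) hε.le
    have : 0 < ε ^ 2 := by positivity
    linarith
  have := (hD.add ((hu.inner hv).const_mul c)).add
    ((hu.inner (tendsto_const_nhds (x := A.adjoint y))).sub
      ((hu.inner (tendsto_const_nhds (x := (y : H)))).const_mul c))
  convert this using 1
  · funext n
    ring
  · congr 1
    ring

theorem minDomain_le_friedrichsDomain (hB : IsLowerBounded A) :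
    minDomain A ≤ friedrichsDomain A hB := fun x hx =>
  ⟨fun _ => ⟨x, hx⟩, tendsto_const_nhds, by simp [opForm]⟩

/-- The Friedrichs extension is symmetric. -/
theorem boundaryForm_of_mem_friedrichsDomain (hd : Dense (A.domain : Set H))
    (hsym : A ≤ A.adjoint) (hB : IsLowerBounded A) {x y : A.adjoint.domain}
    (hx : x ∈ friedrichsDomain A hB) (hy : y ∈ friedrichsDomain A hB) : boundaryForm A x y = 0 := by
  obtain ⟨u, hu, hqu⟩ := hx
  obtain ⟨v, hv, hqv⟩ := hy
  have h1 := tendsto_inner_of_form_cauchy hd hsym hB hu hv hqu hqv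
  have h2 := tendsto_inner_of_form_cauchy hd hsym hB hv hu hqv hqu
  have h3 : ∀ n, inner ℝ (A (u n)) (v n : H) = inner ℝ (A (v n)) (u n : H) := fun n => by
    rw [inner_apply_comm hd hsym, real_inner_comm]
  simp_rw [h3] at h1
  rw [boundaryForm_apply, tendsto_nhds_unique h1 h2, real_inner_comm, sub_self]

/-- A shift of the Friedrichs extension is onto.  A solution `y` of `A_F y + s y = h` is the limit
of a minimizing sequence of `⟨A a, a⟩ + s ‖a‖² - 2 ⟨h, a⟩` on `dom A`. -/
theorem exists_friedrichs_solution (hd : Dense (A.domain : Set H)) (hsym : A ≤ A.adjoint)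
    (hB : IsLowerBounded A) : ∃ s : ℝ, ∀ h : H, ∃ y ∈ friedrichsDomain A hB,
      A.adjoint y + s • (y : H) = h := by
  obtain ⟨c, hc⟩ := id hB
  -- with `s = 1 - c` the shifted form dominates the square of the norm
  refine ⟨1 - c, fun h => ?_⟩
  let Q := shiftedForm A (c - 1)
  have hQ : ∀ a : A.domain, ‖(a : H)‖ ^ 2 ≤ Q a a := fun a => by
    have := hc a
    rw [shiftedForm_self]
    linarith
  have hQs : ∀ a b, Q a b = Q b a := shiftedForm_comm hd hsym _
  let J : A.domain → ℝ := fun a => Q a a - 2 * inner ℝ h (a : H)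
  have hJ : ∀ a, -‖h‖ ^ 2 ≤ J a := fun a => by
    have h1 := hQ a
    have h2 := real_inner_le_norm h (a : H)
    have h3 := sq_nonneg (‖(a : H)‖ - ‖h‖)
    change _ ≤ Q a a - 2 * inner ℝ h (a : H)
    nlinarith
  have hbdd : BddBelow (Set.range J) := ⟨-‖h‖ ^ 2, by rintro _ ⟨a, rfl⟩; exact hJ a⟩
  set m := ⨅ a, J a with hm
  have hmle : ∀ a, m ≤ J a := fun a => ciInf_le hbdd a
  have hex : ∀ n : ℕ, ∃ a, J a < m + 1 / ((n : ℝ) + 1) := fun n =>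
    exists_lt_of_ciInf_lt (lt_add_of_pos_right _ (by positivity))
  choose u hu using hex
  have hpar : ∀ n k, Q (u n - u k) (u n - u k) ≤ 2 * (1 / ((n : ℝ) + 1)) + 2 * (1 / ((k : ℝ) + 1)) := by
    intro n k
    have h1 := hmle ((1 / 2 : ℝ) • (u n + u k))
    have h2 := hu n
    have h3 := hu k
    simp only [J, map_sub, map_add, map_smul, LinearMap.sub_apply, LinearMap.add_apply,
      LinearMap.smul_apply, Submodule.coe_smul, Submodule.coe_add, inner_smul_right,
      inner_add_right, smul_eq_mul, hQs (u k) (u n)] at h1 h2 h3 ⊢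
    linarith
  have hone := tendsto_one_div_add_atTop_nhds_zero_nat (𝕜 := ℝ)
  have hpt : Tendsto (fun p : ℕ × ℕ => 2 * (1 / ((p.1 : ℝ) + 1)) + 2 * (1 / ((p.2 : ℝ) + 1)))
      atTop (𝓝 0) := by
    rw [← prod_atTop_atTop_eq]
    simpa using ((hone.comp tendsto_fst).const_mul 2).add ((hone.comp tendsto_snd).const_mul 2)
  have hQ0 : Tendsto (fun p : ℕ × ℕ => Q (u p.1 - u p.2) (u p.1 - u p.2)) atTop (𝓝 0) :=
    squeeze_zero (fun p => (sq_nonneg _).trans (hQ _)) (fun p => hpar p.1 p.2) hpt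
  have hn0 : Tendsto (fun p : ℕ × ℕ => ‖((u p.1 - u p.2 : A.domain) : H)‖ ^ 2) atTop (𝓝 0) :=
    squeeze_zero (fun p => sq_nonneg _) (fun p => hQ _) hQ0
  have hcau : CauchySeq fun n => (u n : H) := by
    rw [cauchySeq_iff_tendsto_dist_atTop_0]
    have := hn0.sqrt
    simpa [Real.sqrt_sq, dist_eq_norm] using this
  obtain ⟨y, hy⟩ := cauchySeq_tendsto_of_complete hcau
  have hq0 : Tendsto (fun p : ℕ × ℕ => opForm A (u p.1 - u p.2)) atTop (𝓝 0) := by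
    have := hQ0.add (hn0.const_mul (c - 1))
    rw [mul_zero, add_zero] at this
    refine this.congr fun p => ?_
    rw [shiftedForm_self]
    ring
  -- the Euler-Lagrange equation
  have hEL : ∀ w : A.domain, inner ℝ (h - (1 - c) • y) (w : H) = inner ℝ y (A w) := by
    intro w
    set θ := inner ℝ y (A w) - inner ℝ (h - (1 - c) • y) (w : H) with hθ
    have hlim : ∀ t : ℝ, 0 ≤ 2 * t * θ + t ^ 2 * Q w w := by
      intro t
      have h1 : ∀ n : ℕ, -(1 / ((n : ℝ) + 1)) ≤ 2 * t * (inner ℝ (u n : H) (A w) -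
          (c - 1) * inner ℝ (u n : H) w - inner ℝ h (w : H)) + t ^ 2 * Q w w := fun n => by
        have h2 := hmle (u n + t • w)
        have h3 := hu n
        have h4 : Q (u n) w = inner ℝ (u n : H) (A w) - (c - 1) * inner ℝ (u n : H) w := by
          rw [← inner_apply_comm hd hsym]
          rfl
        simp only [J, map_add, map_smul, LinearMap.add_apply, LinearMap.smul_apply,
          Submodule.coe_smul, Submodule.coe_add, inner_smul_right, inner_add_right, smul_eq_mul,
          hQs w (u n), h4] at h2 h3
        linarith
      have h5 : Tendsto (fun n => 2 * t * (inner ℝ (u n : H) (A w) -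
          (c - 1) * inner ℝ (u n : H) w - inner ℝ h (w : H)) + t ^ 2 * Q w w) atTop
          (𝓝 (2 * t * (inner ℝ y (A w) - (c - 1) * inner ℝ y (w : H) - inner ℝ h (w : H)) +
            t ^ 2 * Q w w)) :=
        ((((hy.inner tendsto_const_nhds).sub ((hy.inner tendsto_const_nhds).const_mul _)).sub
          tendsto_const_nhds).const_mul _).add tendsto_const_nhds
      have h6 := le_of_tendsto_of_tendsto' hone.neg h5 h1
      have h7 : θ = inner ℝ y (A w) - (c - 1) * inner ℝ y (w : H) - inner ℝ h (w : H) := by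
        rw [hθ, inner_sub_left, real_inner_smul_left]
        ring
      rw [h7]
      linarith
    have hθ0 : θ = 0 := by
      by_contra hne
      have hw : 0 ≤ Q w w := (sq_nonneg _).trans (hQ w)
      have h1 := hlim (-θ / (Q w w + 1))
      have h2 : 2 * (-θ / (Q w w + 1)) * θ + (-θ / (Q w w + 1)) ^ 2 * Q w w =
          -(θ ^ 2 * (Q w w + 2)) / (Q w w + 1) ^ 2 := by
        field_simp
        ring
      rw [h2] at h1
      have h3 : 0 < θ ^ 2 * (Q w w + 2) / (Q w w + 1) ^ 2 := by positivity
      rw [neg_div] at h1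
      linarith
    linarith
  let y' : A.adjoint.domain := ⟨y, LinearPMap.mem_adjoint_domain_of_exists _ ⟨_, hEL⟩⟩
  refine ⟨y', ⟨u, hy, hq0⟩, ?_⟩
  rw [LinearPMap.adjoint_apply_eq hd y' hEL]
  exact sub_add_cancel _ _

/-- The Friedrichs extension has no proper symmetric extension inside `A*`. -/
theorem mem_friedrichsDomain_of_boundaryForm (hd : Dense (A.domain : Set H))
    (hsym : A ≤ A.adjoint) (hB : IsLowerBounded A) {x : A.adjoint.domain}
    (hx : ∀ y ∈ friedrichsDomain A hB, boundaryForm A y x = 0) : x ∈ friedrichsDomain A hB := by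
  obtain ⟨s, hs⟩ := exists_friedrichs_solution hd hsym hB
  obtain ⟨y, hy, hyx⟩ := hs (A.adjoint x + s • (x : H))
  set z := x - y with hz
  have hAz : A.adjoint z = -(s • (z : H)) := by
    rw [hz, LinearPMap.map_sub, Submodule.coe_sub, smul_sub, neg_sub, sub_eq_sub_iff_add_eq_add,
      add_comm (s • (y : H)), hyx]
  obtain ⟨w, hw, hwz⟩ := hs z
  have h1 : boundaryForm A w z = 0 := by
    rw [hz, map_sub, hx w hw, boundaryForm_of_mem_friedrichsDomain hd hsym hB hw hy, sub_zero]
  have h2 : inner ℝ (z : H) (z : H) = (0 : ℝ) := by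
    rw [boundaryForm_apply, hAz, inner_neg_right, inner_smul_right] at h1
    have h3 : inner ℝ (A.adjoint w + s • (w : H)) (z : H) = (0 : ℝ) := by
      rw [inner_add_left, real_inner_smul_left]
      linarith
    rwa [hwz] at h3
  have h3 : z = 0 := Subtype.ext (inner_self_eq_zero.1 h2)
  rw [sub_eq_zero.1 (hz.symm.trans h3)]
  exact hy

theorem IsBoundarySetting.isLagrangian_friedrichsSubspace {U : Submodule ℝ A.adjoint.domain}
    (h : IsBoundarySetting A U) (hB : IsLowerBounded A) :
    IsLagrangian (rho A U) (friedrichsSubspace A hB U) := by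
  refine le_antisymm (fun u hu => ?_) fun u hu v hv =>
    boundaryForm_of_mem_friedrichsDomain h.dense h.symm hB hv hu
  refine mem_friedrichsDomain_of_boundaryForm h.dense h.symm hB fun y hy => ?_
  obtain ⟨a, ha, v, hv, rfl⟩ := h.exists_add y
  rw [map_add, LinearMap.add_apply, boundaryForm_of_mem_minDomain h.dense h.symm ha, zero_add]
  have hvF : v ∈ friedrichsDomain A hB := by
    have := Submodule.sub_mem _ hy (minDomain_le_friedrichsDomain hB ha)
    simpa using this
  exact hu ⟨v, hv⟩ hvF

end Friedrichs

/-! ### The Morse index of an extension relative to the Friedrichs extension -/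

section Morse

variable {H : Type*} [NormedAddCommGroup H] [InnerProductSpace ℝ H] [CompleteSpace H]
  {A : H →ₗ.[ℝ] H} {U : Submodule ℝ A.adjoint.domain} {hB : IsLowerBounded A}

/-- The space `dom A_F × Λ`. -/
def FormSpace (hB : IsLowerBounded A) (Λ : Submodule ℝ U) : Type _ := friedrichsDomain A hB × Λ

namespace FormSpace

variable (hB) (Λ : Submodule ℝ U)

noncomputable instance : AddCommGroup (FormSpace hB Λ) :=
  inferInstanceAs (AddCommGroup (friedrichsDomain A hB × Λ))

noncomputable instance : Module ℝ (FormSpace hB Λ) :=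
  inferInstanceAs (Module ℝ (friedrichsDomain A hB × Λ))

/-- The component in `dom A_F`. -/
noncomputable def fst : FormSpace hB Λ →ₗ[ℝ] friedrichsDomain A hB := LinearMap.fst ℝ _ _

/-- The component in `Λ`, as an element of `U`. -/
noncomputable def snd : FormSpace hB Λ →ₗ[ℝ] U := Λ.subtype ∘ₗ LinearMap.snd ℝ _ _

/-- The map `(v, l) ↦ v + l` to `dom A*`. -/
noncomputable def addMap : FormSpace hB Λ →ₗ[ℝ] A.adjoint.domain :=
  (friedrichsDomain A hB).subtype ∘ₗ fst hB Λ + U.subtype ∘ₗ snd hB Λ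

variable {hB Λ}

/-- The pair `(v, l)`. -/
def pair {v : A.adjoint.domain} (hv : v ∈ friedrichsDomain A hB) {l : U} (hl : l ∈ Λ) :
    FormSpace hB Λ := (⟨v, hv⟩, ⟨l, hl⟩)

theorem fst_pair {v : A.adjoint.domain} (hv : v ∈ friedrichsDomain A hB) {l : U} (hl : l ∈ Λ) :
    fst hB Λ (pair hv hl) = ⟨v, hv⟩ := rfl

theorem snd_pair {v : A.adjoint.domain} (hv : v ∈ friedrichsDomain A hB) {l : U} (hl : l ∈ Λ) :
    snd hB Λ (pair hv hl) = l := rfl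

theorem snd_mem (z : FormSpace hB Λ) : snd hB Λ z ∈ Λ := Subtype.prop z.2

theorem addMap_apply (z : FormSpace hB Λ) :
    addMap hB Λ z = (fst hB Λ z : A.adjoint.domain) + (snd hB Λ z : A.adjoint.domain) := rfl

end FormSpace

open FormSpace

/-- The bilinear form `-(⟨A* v, v'⟩ + ⟨v, A* l'⟩ + ⟨A* l, v'⟩ + ⟨A* l, l'⟩)` on
`dom A_F × Λ ∋ (v, l), (v', l')`: minus the form of `A`, extended to `dom A_F + Λ` by letting `A*`
act on the second summand in the mixed terms. -/
noncomputable def extendedForm (hB : IsLowerBounded A) (Λ : Submodule ℝ U) :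
    LinearMap.BilinForm ℝ (FormSpace hB Λ) :=
  let G : LinearMap.BilinForm ℝ A.adjoint.domain :=
    (innerₗ H).compl₁₂ A.adjoint.toFun A.adjoint.domain.subtype
  let v := (friedrichsDomain A hB).subtype ∘ₗ fst hB Λ
  let l := U.subtype ∘ₗ snd hB Λ;
  -(G.compl₁₂ v v + G.flip.compl₁₂ v l + G.compl₁₂ l v + G.compl₁₂ l l)

variable {Λ : Submodule ℝ U}

theorem extendedForm_apply (z w : FormSpace hB Λ) : extendedForm hB Λ z w =
    -(inner ℝ (A.adjoint (fst hB Λ z)) ((fst hB Λ w : A.adjoint.domain) : H) +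
      inner ℝ (A.adjoint (snd hB Λ w)) ((fst hB Λ z : A.adjoint.domain) : H) +
      inner ℝ (A.adjoint (snd hB Λ z)) ((fst hB Λ w : A.adjoint.domain) : H) +
      inner ℝ (A.adjoint (snd hB Λ z)) ((snd hB Λ w : A.adjoint.domain) : H)) := rfl

/-- The index of the Friedrichs extension, as the positive index of minus its form. -/
noncomputable def friedrichsIndex (A : H →ₗ.[ℝ] H) (hB : IsLowerBounded A) : ℕ∞ :=
  posIndex fun x : friedrichsDomain A hB =>
    -inner ℝ (A.adjoint x) ((x : A.adjoint.domain) : H)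

theorem posIndex_extendedForm_ker_snd :
    posIndex (fun z : LinearMap.ker (snd hB Λ) => extendedForm hB Λ z z) =
      friedrichsIndex A hB := by
  have hsurj : Function.Surjective (fst hB Λ ∘ₗ (LinearMap.ker (snd hB Λ)).subtype) :=
    fun x => ⟨⟨pair x.2 Λ.zero_mem, rfl⟩, rfl⟩
  rw [friedrichsIndex, ← posIndex_comp_of_surjective (by simp) hsurj]
  refine congrArg posIndex (funext fun z => ?_)
  have h1 : snd hB Λ z = 0 := z.2
  rw [extendedForm_apply, h1]
  simp only [Submodule.coe_zero, LinearPMap.map_zero, inner_zero_left, add_zero]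
  rfl

theorem adjoint_fst_of_addMap_mem {z : FormSpace hB Λ} (hz : addMap hB Λ z ∈ kerAdjoint A) :
    A.adjoint (fst hB Λ z) = -A.adjoint (snd hB Λ z) := by
  have h1 : A.adjoint (addMap hB Λ z) = 0 := hz
  rw [addMap_apply, LinearPMap.map_add] at h1
  exact eq_neg_of_add_eq_zero_left h1

namespace IsBoundarySetting

variable (h : IsBoundarySetting A U)
include h

theorem mem_cauchySubspace (x : U) :
    x ∈ cauchySubspace A U h.compl ↔ (x : A.adjoint.domain) ∈ kerAdjoint A := by
  rw [h.cauchySubspace_eq]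
  rfl

variable (hΛ : IsLagrangian (rho A U) Λ)
include hΛ

theorem extendedForm_comm (z w : FormSpace hB Λ) :
    extendedForm hB Λ z w = extendedForm hB Λ w z := by
  have h1 := boundaryForm_of_mem_friedrichsDomain h.dense h.symm hB (fst hB Λ z).2 (fst hB Λ w).2
  have h2 := hΛ.apply_eq_zero (snd_mem z) (snd_mem w)
  rw [rho_apply] at h2
  rw [boundaryForm_apply, real_inner_comm] at h1 h2
  rw [extendedForm_apply, extendedForm_apply]
  linarith

omit hΛ in
/-- The Morse index of `A_Λ` is that of the form on `dom A × Λ`, on which `v + l` lies in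
`dom A_Λ`. -/
theorem posIndex_extendedForm_minDomain :
    posIndex (fun z : (minDomain A).comap ((friedrichsDomain A hB).subtype ∘ₗ fst hB Λ) =>
      extendedForm hB Λ z z) = morseIndex (extension A Λ) := by
  let Z := (minDomain A).comap ((friedrichsDomain A hB).subtype ∘ₗ fst hB Λ)
  have hmem : ∀ z : Z, A.adjoint.domain.subtype (addMap hB Λ z) ∈ (extension A Λ).domain := fun z => by
    refine Submodule.mem_inf.2 ⟨Submodule.mem_map_of_mem ?_, (addMap hB Λ z).2⟩
    exact Submodule.add_mem_sup z.2 (Submodule.mem_map_of_mem (snd_mem _))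
  let g : Z →ₗ[ℝ] (extension A Λ).domain :=
    LinearMap.codRestrict _ (A.adjoint.domain.subtype ∘ₗ addMap hB Λ ∘ₗ Z.subtype) hmem
  have hg : ∀ z : Z, (g z : H) = addMap hB Λ z := fun z => rfl
  have hsurj : Function.Surjective g := by
    rintro ⟨x, ⟨y, hy, rfl⟩, hx⟩
    obtain ⟨a, ha, _, ⟨l, hl, rfl⟩, rfl⟩ := Submodule.mem_sup.1 hy
    exact ⟨⟨pair (minDomain_le_friedrichsDomain hB ha) hl, ha⟩, rfl⟩
  rw [morseIndex, negIndex, ← posIndex_comp_of_surjective (by simp [opForm]) hsurj]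
  refine congrArg posIndex (funext fun z => ?_)
  have e1 : extension A Λ (g z) = A.adjoint (addMap hB Λ z) := LinearPMap.domRestrict_apply rfl
  have e2 := h.inner_adjoint (snd hB Λ z : A.adjoint.domain) (x := fst hB Λ z) z.2
  rw [real_inner_comm (A.adjoint (fst hB Λ z))] at e2
  rw [opForm, e1, hg, extendedForm_apply, addMap_apply, LinearPMap.map_add, Submodule.coe_add,
    inner_add_left, inner_add_right, inner_add_right]
  linarith

/-- The Morse index of `A_Λ` is that of the form on `dom A_F × Λ`, because `dom A` is dense in
`dom A_F` for the form of `A`. -/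
theorem posIndex_extendedForm :
    posIndex (fun z : FormSpace hB Λ => extendedForm hB Λ z z) =
      morseIndex (extension A Λ) := by
  rw [← h.posIndex_extendedForm_minDomain (Λ := Λ) (hB := hB)]
  refine posIndex_eq_of_dense (B := extendedForm hB Λ) (h.extendedForm_comm hΛ) _ fun z => ?_
  set x : A.adjoint.domain := (fst hB Λ z : A.adjoint.domain) with hx
  have hxF : x ∈ friedrichsDomain A hB := (fst hB Λ z).2
  obtain ⟨u, hu, hq⟩ := id hxF
  let x' : ℕ → A.adjoint.domain := fun n => ⟨u n, h.symm.1 (u n).2⟩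
  have hx' : ∀ n, x' n ∈ minDomain A := fun n => (u n).2
  have hx'F : ∀ n, x' n ∈ friedrichsDomain A hB := fun n =>
    minDomain_le_friedrichsDomain hB (hx' n)
  have hAx' : ∀ n, A.adjoint (x' n) = A (u n) := fun n =>
    adjoint_apply_of_le h.symm (a := u n) rfl
  have hlim : ∀ y : H, Tendsto (fun n => inner ℝ y (x' n : H)) atTop (𝓝 (inner ℝ y (x : H))) :=
    fun y => tendsto_const_nhds.inner hu
  refine ⟨fun n => ⟨pair (hx'F n) (snd_mem z), hx' n⟩, fun w => ?_, ?_⟩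
  · simp only [extendedForm_apply, fst_pair, snd_pair]
    refine Tendsto.neg (((Tendsto.add ?_ (hlim _)).add tendsto_const_nhds).add
      tendsto_const_nhds)
    have e : ∀ y ∈ friedrichsDomain A hB,
        inner ℝ (A.adjoint y) ((fst hB Λ w : A.adjoint.domain) : H) =
          inner ℝ (A.adjoint (fst hB Λ w)) (y : H) := fun y hy => by
      have := boundaryForm_of_mem_friedrichsDomain h.dense h.symm hB hy (fst hB Λ w).2
      rw [boundaryForm_apply, real_inner_comm] at this
      linarith
    have := hlim (A.adjoint (fst hB Λ w))
    rw [← e x hxF] at this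
    refine this.congr fun n => ?_
    rw [← e _ (hx'F n)]
  · simp only [extendedForm_apply, fst_pair, snd_pair]
    refine Tendsto.neg (((Tendsto.add ?_ (hlim _)).add (hlim _)).add tendsto_const_nhds)
    have := tendsto_inner_of_form_cauchy h.dense h.symm hB (y := x) hu hu hq hq
    rw [real_inner_comm] at this
    refine this.congr fun n => ?_
    rw [hAx']

/-- On the pairs `(v, l)` with `u = v + l ∈ ker A*` the extended form is `Q(K, Λ; Λ_D)[u]`. -/
theorem posIndex_extendedForm_ker :
    posIndex (fun z : (kerAdjoint A).comap (addMap hB Λ) => extendedForm hB Λ z z) =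
      posIndex (tripleForm (rho A U) (cauchySubspace A U h.compl) Λ
        (friedrichsSubspace A hB U)) := by
  have hD := h.isLagrangian_friedrichsSubspace hB
  let g : (kerAdjoint A).comap (addMap hB Λ) →ₗ[ℝ] U := LinearMap.codRestrict U
    (addMap hB Λ ∘ₗ ((kerAdjoint A).comap (addMap hB Λ)).subtype) fun z => h.ker_le z.2
  have hg : ∀ z, (g z : A.adjoint.domain) = addMap hB Λ z := fun z => rfl
  symm
  refine posIndex_tripleForm_eq hΛ hD g (fun z => -(snd hB Λ z)) _
    (fun z => (h.mem_cauchySubspace _).2 z.2) (fun x hx => ?_)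
    (fun z => Λ.neg_mem (snd_mem _)) (fun z => ?_) (fun z => ?_)
  · obtain ⟨l, hl, v, hv, hlv⟩ := Submodule.mem_sup.1 hx.2
    have hvF : (v : A.adjoint.domain) ∈ friedrichsDomain A hB := hv
    have hz : addMap hB Λ (pair hvF hl) = x := by
      rw [addMap_apply, fst_pair, snd_pair, ← hlv, Submodule.coe_add, add_comm]
    refine ⟨⟨pair hvF hl, ?_⟩, Subtype.ext hz⟩
    rw [Submodule.mem_comap, hz]
    exact (h.mem_cauchySubspace x).1 hx.1
  · change addMap hB Λ z + -(snd hB Λ z : A.adjoint.domain) ∈ friedrichsDomain A hB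
    rw [addMap_apply, add_neg_cancel_right]
    exact (fst hB Λ z).2
  · have h1 : A.adjoint (addMap hB Λ z) = 0 := z.2
    rw [map_neg, rho_apply, hg, boundaryForm_apply, h1, inner_zero_left, sub_zero,
      extendedForm_apply, adjoint_fst_of_addMap_mem z.2, addMap_apply, Submodule.coe_add,
      inner_add_left, real_inner_comm (A.adjoint (snd hB Λ z)),
      real_inner_comm (A.adjoint (snd hB Λ z)), inner_neg_left]
    linarith

/-- `iMor(A_Λ) = iMor(A_F) + n₊ Q(K, Λ; Λ_D) + dim C` with `C` a complement of `K ∩ Λ ∩ Λ_D` in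
`K ∩ Λ_D`, by `posIndex_eq_add`: the orthogonal of `dom A_F × 0` for the extended form consists of
the `(v, l)` with `v + l ∈ ker A*`. -/
theorem morseIndex_extension {C : Submodule ℝ U}
    (hC : C ≤ cauchySubspace A U h.compl ⊓ friedrichsSubspace A hB U)
    (hCΛ : ∀ x ∈ C, x ∈ Λ → x = 0) (hCfin : Module.finrank ℝ C +
      Module.finrank ℝ ↥(cauchySubspace A U h.compl ⊓ Λ ⊓ friedrichsSubspace A hB U) =
      Module.finrank ℝ ↥(cauchySubspace A U h.compl ⊓ friedrichsSubspace A hB U)) :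
    morseIndex (extension A Λ) = friedrichsIndex A hB +
      posIndex (tripleForm (rho A U) (cauchySubspace A U h.compl) Λ (friedrichsSubspace A hB U)) +
      (Module.finrank ℝ C : ℕ∞) := by
  have := h.finiteDimensional
  have hK := h.isLagrangian_cauchySubspace
  have hD := h.isLagrangian_friedrichsSubspace hB
  have hCK : ∀ c : C, A.adjoint (c : U) = 0 := fun c => (h.mem_cauchySubspace c).1 (hC c.2).1
  let E : Submodule ℝ (FormSpace hB Λ) := (kerAdjoint A).comap (addMap hB Λ)
  have hCF : ∀ c : C, ((c : U) : A.adjoint.domain) ∈ friedrichsDomain A hB := fun c => (hC c.2).2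
  let j : C →ₗ[ℝ] FormSpace hB Λ := LinearMap.prod
    (LinearMap.codRestrict (friedrichsDomain A hB) (U.subtype ∘ₗ C.subtype) hCF) (0 : C →ₗ[ℝ] Λ)
  have hj1 : ∀ c, (fst hB Λ (j c) : A.adjoint.domain) = (c : U) := fun c => rfl
  have hj2 : ∀ c, snd hB Λ (j c) = 0 := fun c => rfl
  have hj : Function.Injective j := fun x y hxy =>
    Subtype.ext (Subtype.ext (congrArg (fun z => (fst hB Λ z : A.adjoint.domain)) hxy))
  have hjE : LinearMap.range j ≤ E := by
    rintro _ ⟨c, rfl⟩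
    rw [Submodule.mem_comap, addMap_apply, hj1, hj2, Submodule.coe_zero, add_zero]
    exact hCK c
  have hortho : ∀ y, snd hB Λ y = 0 → ∀ e ∈ E, extendedForm hB Λ y e = 0 := fun y hy e he => by
    have h2 := boundaryForm_of_mem_friedrichsDomain h.dense h.symm hB (fst hB Λ y).2
      (fst hB Λ e).2
    rw [boundaryForm_apply, adjoint_fst_of_addMap_mem he, inner_neg_right,
      real_inner_comm (A.adjoint (snd hB Λ e))] at h2
    rw [extendedForm_apply, hy]
    simp only [Submodule.coe_zero, LinearPMap.map_zero, inner_zero_left, add_zero]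
    linarith
  have hrad : ∀ c ∈ LinearMap.range j, (∀ x, extendedForm hB Λ c x = 0) → c = 0 := by
    rintro _ ⟨c, rfl⟩ hc
    have h1 : (c : U) ∈ Λ := hΛ.mem fun m hm => by
      have h2 := hc (pair (Submodule.zero_mem _) hm)
      rw [extendedForm_apply, hj1, hj2, hCK, snd_pair] at h2
      simp only [Submodule.coe_zero, LinearPMap.map_zero, inner_zero_left,
        add_zero, zero_add, neg_eq_zero] at h2
      rw [rho_apply, boundaryForm_apply, hCK, inner_zero_right, h2, sub_zero]
    rw [show c = 0 from Subtype.ext (hCΛ c c.2 h1), map_zero]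
  have hdim : Module.finrank ℝ (LinearMap.range (snd hB Λ)) ≤
      Module.finrank ℝ (E.map (snd hB Λ)) + Module.finrank ℝ (LinearMap.range j) := by
    have h1 : LinearMap.range (snd hB Λ) ≤ Λ := by
      rintro _ ⟨z, rfl⟩
      exact snd_mem z
    have h2 : Λ ⊓ (cauchySubspace A U h.compl ⊔ friedrichsSubspace A hB U) ≤
        E.map (snd hB Λ) := by
      rintro l ⟨hl, hl'⟩
      obtain ⟨k, hk, v, hv, rfl⟩ := Submodule.mem_sup.1 hl'
      have hvF : -(v : A.adjoint.domain) ∈ friedrichsDomain A hB := Submodule.neg_mem _ hv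
      refine ⟨pair hvF hl, ?_, snd_pair _ _⟩
      change addMap hB Λ (pair hvF hl) ∈ kerAdjoint A
      rw [addMap_apply, fst_pair, snd_pair, Submodule.coe_add, add_comm (k : A.adjoint.domain),
        neg_add_cancel_left]
      exact (h.mem_cauchySubspace k).1 hk
    have h3 := Submodule.finrank_mono h1
    have h4 := Submodule.finrank_mono h2
    have h5 := finrank_inf_sup rho_isAlt h.rho_nondegenerate hK hΛ hD
    rw [LinearMap.finrank_range_of_inj hj]
    omega
  have hmain := posIndex_eq_add (B := extendedForm hB Λ) (h.extendedForm_comm hΛ) (snd hB Λ) E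
    (LinearMap.range j) hortho hjE (by
      rintro _ ⟨c, rfl⟩
      exact hj2 c) hrad hdim
  rw [h.posIndex_extendedForm hΛ, LinearMap.finrank_range_of_inj hj,
    posIndex_extendedForm_ker_snd, h.posIndex_extendedForm_ker hΛ] at hmain
  exact hmain

end IsBoundarySetting

/-- The abstract Morse index theorem for Lagrangian extensions. -/
theorem IsBoundarySetting.morseIndex_sub (h : IsBoundarySetting A U) (hB : IsLowerBounded A)
    {Λ₀ Λ₁ : Submodule ℝ U} (h₀ : IsLagrangian (rho A U) Λ₀) (h₁ : IsLagrangian (rho A U) Λ₁) :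
    (morseIndex (extension A Λ₁) = ⊤ ↔ morseIndex (extension A Λ₀) = ⊤) ∧
      (morseIndex (extension A Λ₀) ≠ ⊤ →
        ((morseIndex (extension A Λ₁)).toNat : ℤ) - ((morseIndex (extension A Λ₀)).toNat : ℤ) =
          tripleIndex (rho A U) (cauchySubspace A U h.compl) Λ₁ Λ₀ -
            tripleIndex (rho A U) Λ₁ Λ₀ (friedrichsSubspace A hB U)) := by
  have := h.finiteDimensional
  have hK := h.isLagrangian_cauchySubspace
  have hD := h.isLagrangian_friedrichsSubspace hB
  have key : ∀ {Λ : Submodule ℝ U}, IsLagrangian (rho A U) Λ →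
      (morseIndex (extension A Λ) = ⊤ ↔ friedrichsIndex A hB = ⊤) ∧
      (friedrichsIndex A hB ≠ ⊤ → ((morseIndex (extension A Λ)).toNat : ℤ) =
        (friedrichsIndex A hB).toNat + tripleIndex (rho A U) (cauchySubspace A U h.compl) Λ
          (friedrichsSubspace A hB U)) := by
    intro Λ hΛ
    obtain ⟨C, h1, h2, h3⟩ := exists_compl_inf (cauchySubspace A U h.compl) Λ
      (friedrichsSubspace A hB U)
    have h4 := h.morseIndex_extension hΛ h1 h2 h3
    have n1 := posIndex_ne_top (tripleForm (rho A U) (cauchySubspace A U h.compl) Λ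
      (friedrichsSubspace A hB U)) (tripleForm_zero hΛ hD)
    unfold tripleIndex
    lift posIndex (tripleForm (rho A U) (cauchySubspace A U h.compl) Λ
      (friedrichsSubspace A hB U)) to ℕ using n1 with k
    rw [h4]
    refine ⟨by simp, fun hne => ?_⟩
    lift friedrichsIndex A hB to ℕ using hne with m
    rw [← Nat.cast_add, ← Nat.cast_add]
    simp only [ENat.toNat_natCast]
    omega
  obtain ⟨a0, b0⟩ := key h₀
  obtain ⟨a1, b1⟩ := key h₁
  refine ⟨a1.trans a0.symm, fun hne => ?_⟩
  have hfin : friedrichsIndex A hB ≠ ⊤ := fun ht => hne (a0.2 ht)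
  have hc := tripleIndex_cocycle rho_isAlt h.rho_nondegenerate hK h₁ h₀ hD
  rw [b1 hfin, b0 hfin]
  linarith

end Morse

open scoped ContDiff

/-! ### Closures of symmetric operators -/

section SymmetricClosure

variable {H : Type*} [NormedAddCommGroup H] [InnerProductSpace ℝ H]

theorem closure_le_of_isClosed {A B : H →ₗ.[ℝ] H} (hB : B.IsClosed) (h : A ≤ B) :
    A.closure ≤ B := by
  refine LinearPMap.le_of_le_graph ?_
  rw [← (hB.isClosable.leIsClosable h).graph_closure_eq_closure_graph]
  exact Submodule.topologicalClosure_minimal _ (LinearPMap.le_graph_of_le h) hB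

theorem dense_domain_closure {A : H →ₗ.[ℝ] H} (hA : Dense (A.domain : Set H)) :
    Dense (A.closure.domain : Set H) :=
  hA.mono A.le_closure.1

variable [CompleteSpace H] {A : H →ₗ.[ℝ] H}

theorem isClosed_closure_of_isFormalAdjoint (hA : Dense (A.domain : Set H))
    (hs : A.IsFormalAdjoint A) : A.closure.IsClosed :=
  ((LinearPMap.adjoint_isClosed hA).isClosable.leIsClosable
    (hs.le_adjoint hA)).closure_isClosed

/-- The closure of a densely defined symmetric operator is symmetric. -/
theorem closure_le_adjoint_closure (hA : Dense (A.domain : Set H)) (hs : A.IsFormalAdjoint A) :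
    A.closure ≤ A.closure.adjoint := by
  have h1 : A.closure ≤ A.adjoint :=
    closure_le_of_isClosed (LinearPMap.adjoint_isClosed hA) (hs.le_adjoint hA)
  have h2 : A.closure.IsFormalAdjoint A := fun x y => by
    have e : A.closure x = A.adjoint ⟨x, h1.1 x.2⟩ := h1.2 rfl
    rw [e]
    exact LinearPMap.adjoint_isFormalAdjoint hA _ y
  have hd := dense_domain_closure hA
  exact closure_le_of_isClosed (LinearPMap.adjoint_isClosed hd) (h2.le_adjoint hd)

end SymmetricClosure

/-! ### The minimal Sturm-Liouville operator -/

namespace SturmLiouville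

variable {V E : Type*} {G : MetricGraph V E} {d : ℕ} (c : SturmLiouville G d)

/-- The Lagrange identity: `⟪ℓ f, g⟫ - ⟪f, ℓ g⟫` is the derivative of the boundary expression
`⟪f, g^[1]⟫ - ⟪f^[1], g⟫`. -/
theorem hasDerivAt_wronskian {f g : E → ℝ → Vec d} (hf : f ∈ testFunctions G d)
    (hg : g ∈ testFunctions G d) (e : E) (t : ℝ) :
    HasDerivAt (fun s => inner ℝ (f e s) (c.quasiDeriv g e s)
        - inner ℝ (c.quasiDeriv f e s) (g e s))
      (inner ℝ (c.expr f e t) (g e t) - inner ℝ (f e t) (c.expr g e t)) t := by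
  have hf' := ((testFunctions_spec hf e).1.differentiable (by simp) t).hasDerivAt
  have hg' := ((testFunctions_spec hg e).1.differentiable (by simp) t).hasDerivAt
  have hqf := ((c.quasiDeriv_contDiffAt hf e t).differentiableAt (by simp)).hasDerivAt
  have hqg := ((c.quasiDeriv_contDiffAt hg e t).differentiableAt (by simp)).hasDerivAt
  refine ((hf'.inner ℝ hqg).sub (hqf.inner ℝ hg')).congr_deriv ?_
  by_cases ht : t ∈ G.inner e
  · have hP := (c.symm_P e t (G.inner_subset_edge e ht)).isSymmetric (deriv (f e) t)
      (deriv (g e) t)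
    have hR := (c.symm_R e t (G.inner_subset_edge e ht)).isSymmetric (f e t) (g e t)
    simp only [ContinuousLinearMap.coe_coe] at hP hR
    have e1 : inner ℝ ((c.Q e t).adjoint (deriv (f e) t)) (g e t)
        = inner ℝ (deriv (f e) t) (c.Q e t (g e t)) :=
      ContinuousLinearMap.adjoint_inner_left _ _ _
    have e2 : inner ℝ (f e t) ((c.Q e t).adjoint (deriv (g e) t))
        = inner ℝ (c.Q e t (f e t)) (deriv (g e) t) :=
      ContinuousLinearMap.adjoint_inner_right _ _ _
    simp only [expr, inner_add_left, inner_add_right, inner_neg_left, inner_neg_right, e1, e2, hR]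
    simp only [quasiDeriv, inner_add_left, inner_add_right, hP]
    ring
  -- off the interior nothing is assumed on the coefficients, but `f` and `g` vanish near `t`
  · have zf := eventually_zero fun h => ht ((testFunctions_spec hf e).2.2 h)
    have zg := eventually_zero fun h => ht ((testFunctions_spec hg e).2.2 h)
    have zf' : deriv (f e) t = 0 := by simpa using zf.deriv_eq
    have zg' : deriv (g e) t = 0 := by simpa using zg.deriv_eq
    simp [zf.self_of_nhds, zg.self_of_nhds, zf', zg']

theorem setIntegral_inner_expr {f g : E → ℝ → Vec d} (hf : f ∈ testFunctions G d)
    (hg : g ∈ testFunctions G d) (e : E) :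
    ∫ t in G.inner e, inner ℝ (c.expr f e t) (g e t)
      = ∫ t in G.inner e, inner ℝ (f e t) (c.expr g e t) := by
  have cf := (testFunctions_spec hf e).1.continuous
  have cg := (testFunctions_spec hg e).1.continuous
  have zf : ∀ t ∉ tsupport (f e), f e t = 0 := fun t => image_eq_zero_of_notMem_tsupport
  have ef : ∀ t ∉ tsupport (f e), c.expr f e t = 0 := fun t ht =>
    (c.expr_eventually_zero ht).self_of_nhds
  have qf : ∀ t ∉ tsupport (f e), c.quasiDeriv f e t = 0 := fun t ht =>
    (c.quasiDeriv_eventually_zero ht).self_of_nhds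
  have i1 : Integrable fun t => (inner ℝ (c.expr f e t) (g e t) : ℝ) :=
    ((c.continuous_expr hf e).inner cg).integrable_of_hasCompactSupport
      (HasCompactSupport.intro (testFunctions_spec hf e).2.1 fun t ht => by simp [ef t ht])
  have i2 : Integrable fun t => (inner ℝ (f e t) (c.expr g e t) : ℝ) :=
    (cf.inner (c.continuous_expr hg e)).integrable_of_hasCompactSupport
      (HasCompactSupport.intro (testFunctions_spec hf e).2.1 fun t ht => by simp [zf t ht])
  have hW := c.hasDerivAt_wronskian hf hg e
  have i3 := (continuous_iff_continuousAt.2 fun t =>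
    (hW t).continuousAt).integrable_of_hasCompactSupport (μ := volume)
      (HasCompactSupport.intro (testFunctions_spec hf e).2.1 fun t ht => by
        simp [zf t ht, qf t ht])
  have h0 := integral_eq_zero_of_hasDerivAt_of_integrable hW (i1.sub i2) i3
  rw [integral_sub i1 i2, sub_eq_zero] at h0
  have hin : ∀ t ∉ G.inner e, t ∉ tsupport (f e) := fun t ht h =>
    ht ((testFunctions_spec hf e).2.2 h)
  rwa [setIntegral_eq_integral_of_forall_compl_eq_zero fun t ht => by simp [ef t (hin t ht)],
    setIntegral_eq_integral_of_forall_compl_eq_zero fun t ht => by simp [zf t (hin t ht)]]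

theorem single_mem_testFunctions [DecidableEq E] {e : E} {φ : ℝ → ℝ} (h1 : ContDiff ℝ ∞ φ)
    (h2 : HasCompactSupport φ) (h3 : tsupport φ ⊆ G.inner e) (v : Vec d) :
    (Pi.single e fun t => φ t • v : E → ℝ → Vec d) ∈ testFunctions G d := by
  intro e'
  rcases eq_or_ne e' e with rfl | hne
  · rw [Pi.single_eq_same]
    exact ⟨h1.smul contDiff_const, h2.smul_right (f' := fun _ => v),
      (tsupport_smul_subset_left φ fun _ => v).trans h3⟩
  · rw [Pi.single_eq_of_ne hne]
    exact (testFunctions G d).zero_mem e'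

variable [Fintype E]

theorem preminimal_apply (f : testFunctions G d) (h : testToL2 G d f ∈ c.preminimal.domain) :
    c.preminimal ⟨testToL2 G d f, h⟩ = c.exprToL2 f := by
  change c.exprToL2 ((LinearEquiv.ofInjective (testToL2 G d) testToL2_injective).symm _) = _
  congr 1
  exact (LinearEquiv.ofInjective (testToL2 G d) testToL2_injective).symm_apply_apply f

theorem isFormalAdjoint_preminimal : c.preminimal.IsFormalAdjoint c.preminimal := by
  rintro ⟨x, hx⟩ ⟨y, hy⟩
  obtain ⟨f, rfl⟩ := LinearMap.mem_range.1 hx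
  obtain ⟨g, rfl⟩ := LinearMap.mem_range.1 hy
  rw [preminimal_apply, preminimal_apply, PiLp.inner_apply, PiLp.inner_apply]
  refine Finset.sum_congr rfl fun e _ => ?_
  rw [L2.inner_def, L2.inner_def]
  refine Eq.trans (integral_congr_ae ?_) ((c.setIntegral_inner_expr f.2 g.2 e).trans
    (integral_congr_ae ?_))
  · filter_upwards [(c.memLp_expr f.2 e).coeFn_toLp, (memLp_test g.2 e).coeFn_toLp] with t h1 h2
    exact congrArg₂ _ h1 h2
  · filter_upwards [(memLp_test f.2 e).coeFn_toLp, (c.memLp_expr g.2 e).coeFn_toLp] with t h1 h2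
    exact (congrArg₂ _ h1 h2).symm

/-- Smooth functions compactly supported in the interiors of the edges are dense in `L²`. -/
theorem dense_range_testToL2 : Dense (LinearMap.range (testToL2 G d) : Set (G.L2 d)) := by
  classical
  rw [Submodule.dense_iff_topologicalClosure_eq_top, Submodule.topologicalClosure_eq_top_iff,
    Submodule.eq_bot_iff]
  intro F hF
  refine PiLp.ext fun e => ?_
  have hloc : LocallyIntegrable (F e) (volume.restrict (G.inner e)) :=
    (Lp.memLp (F e)).locallyIntegrable (by norm_num)
  have hzero : ∀ᵐ t ∂volume.restrict (G.inner e), t ∈ G.inner e → F e t = 0 := by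
    refine (G.isOpen_inner e).ae_eq_zero_of_integral_contDiff_smul_eq_zero
      (hloc.locallyIntegrableOn _) fun φ h1 h2 h3 => ?_
    have hint : Integrable (fun t => φ t • F e t) (volume.restrict (G.inner e)) :=
      hloc.integrable_smul_left_of_hasCompactSupport h1.continuous h2
    -- pair with an arbitrary `v` and test `F` against `φ • v` on the edge `e`
    refine ext_inner_left ℝ fun v => ?_
    rw [inner_zero_right, ← integral_inner hint]
    have hm := single_mem_testFunctions h1 h2 h3 v
    have h := (Submodule.mem_orthogonal _ F).1 hF _ ⟨⟨_, hm⟩, rfl⟩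
    rw [PiLp.inner_apply, Finset.sum_eq_single e ?_ (by simp), L2.inner_def] at h
    · rw [← h]
      refine integral_congr_ae ?_
      filter_upwards [(memLp_test hm e).coeFn_toLp] with t ht
      refine Eq.trans ?_ (congrArg (fun w => inner ℝ w (F e t)) ht).symm
      simp only [Pi.single_eq_same, real_inner_smul_left, real_inner_smul_right]
    · intro e' _ hne
      have : (memLp_test hm e').toLp _ = 0 := by
        rw [Lp.eq_zero_iff_ae_eq_zero]
        refine (memLp_test hm e').coeFn_toLp.trans (.of_forall fun t => ?_)
        simp only [Pi.single_eq_of_ne hne]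
      exact (congrArg (fun w => inner ℝ w (F e')) this).trans (inner_zero_left _)
  refine (Lp.eq_zero_iff_ae_eq_zero).2 ?_
  filter_upwards [hzero, ae_restrict_mem (G.isOpen_inner e).measurableSet] with t h1 h2
  exact h1 h2

theorem isBoundarySetting_minimal (hF : IsFredholm c.minimal.adjoint)
    {U : Submodule ℝ c.minimal.adjoint.domain} (hU : IsCompl (minDomain c.minimal) U)
    (hker : kerAdjoint c.minimal ≤ U) : IsBoundarySetting c.minimal U where
  dense := dense_domain_closure (A := c.preminimal) dense_range_testToL2
  closed := isClosed_closure_of_isFormalAdjoint (A := c.preminimal) dense_range_testToL2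
    c.isFormalAdjoint_preminimal
  symm := closure_le_adjoint_closure (A := c.preminimal) dense_range_testToL2
    c.isFormalAdjoint_preminimal
  fredholm := hF
  compl := hU
  ker_le := hker

end SturmLiouville

end QuantumGraph

theorem mainTheorem4 {V E : Type*} [Finite V] [Fintype E]
    (G : QuantumGraph.MetricGraph V E) (d : ℕ) (c : QuantumGraph.SturmLiouville G d)
    (hF : QuantumGraph.IsFredholm c.minimal.adjoint)
    (hB : QuantumGraph.IsLowerBounded c.minimal)
    (U : Submodule ℝ c.minimal.adjoint.domain)
    (hU : IsCompl (QuantumGraph.minDomain c.minimal) U)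
    (hker : QuantumGraph.kerAdjoint c.minimal ≤ U)
    (Λ₀ Λ₁ : Submodule ℝ U)
    (h₀ : QuantumGraph.IsLagrangian (QuantumGraph.rho c.minimal U) Λ₀)
    (h₁ : QuantumGraph.IsLagrangian (QuantumGraph.rho c.minimal U) Λ₁) :
    let L := c.minimal
    let ρ := QuantumGraph.rho L U
    let K := QuantumGraph.cauchySubspace L U hU
    let ΛD := QuantumGraph.friedrichsSubspace L hB U
    let m₀ := QuantumGraph.morseIndex (QuantumGraph.extension L Λ₀)
    let m₁ := QuantumGraph.morseIndex (QuantumGraph.extension L Λ₁)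
    FiniteDimensional ℝ U ∧ QuantumGraph.IsLagrangian ρ K ∧ QuantumGraph.IsLagrangian ρ ΛD ∧
      (m₁ = ⊤ ↔ m₀ = ⊤) ∧
      (m₀ ≠ ⊤ → (m₁.toNat : ℤ) - (m₀.toNat : ℤ) =
        QuantumGraph.tripleIndex ρ K Λ₁ Λ₀ - QuantumGraph.tripleIndex ρ Λ₁ Λ₀ ΛD) := by

  intro L ρ K ΛD m₀ m₁
  have h := c.isBoundarySetting_minimal hF hU hker
  exact ⟨h.finiteDimensional, h.isLagrangian_cauchySubspace, h.isLagrangian_friedrichsSubspace hB,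
    h.morseIndex_sub hB h₀ h₁⟩
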